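/- **Theorem 3.1.** Let $a_i,b_i,c_i$ $(i=1,2)$, $\gamma$, $\delta$ be positive constants and put $$f(u,v)=u(a_1-b_1u-c_1v),\qquad g(u,v)=v(a_2-b_2u-c_2v),$$ $$u(w,\tau)=\frac{\sqrt{w^2+4\gamma\delta\tau}+w}{2\delta},\qquad v(w,\tau)=\frac{\tau}{u(w,\tau)}=\frac{\sqrt{w^2+4\gamma\delta\tau}-w}{2\gamma}.$$ For a bounded domain $\Omega\subset\mathbb R^N$ $(N\ge1)$ with smooth boundary $\partial\Omega$ (a bounded open interval if $N=1$), with outward unit normal $\nu$ on $\partial\Omega$, and for $d>0$, a solution of the limiting system is a pair $(w,\tau)$ with $w\in C^2(\overline\Omega)$ and $\tau>0$ such that, with $u=u(w,\tau)$ and $v=v(w,\tau)$, $$d\,\Delta w+f(u,v)-\gamma\, g(u,v)=0\ \text{ in }\Omega,\qquad \partial_\nu w=0\ \text{ on }\partial\Omega,\qquad \int_\Omega f(u,v)\,dx=0 .$$ It is called nonconstant if $w$ is not a constant function on $\overline\Omega$. (a) There is a constant $C^*>0$ depending only on $a_i,b_i,c_i,\gamma,\delta$ such that, for every such $N$, $\Omega$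 and $d>0$, every solution $(w,\tau)$ satisfies $$\|w\|_\infty\le C^*\qquad\text{and}\qquad \tau\le\min\Bigl\{\frac{a_1^2}{4b_1c_1},\frac{a_2^2}{4b_2c_2}\Bigr\},$$ where $\|w\|_\infty$ is the essential supremum of $|w|$ over $\overline\Omega$. (b) For every such domain $\Omega$ there is $\overline d>0$, depending only on $\Omega$ and $a_i,b_i,c_i,\gamma,\delta$, such that for every $d>\overline d$ the limiting system on $\Omega$ has no nonconstant solution. -/

import Mathlib

open MeasureTheory Set Filter Topology
open scoped ContDiff ENNReal

noncomputable section

namespace FullCross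

/-- `Ω` is a bounded domain (nonempty, open, connected, bounded) of `ℝᴺ` with a smooth boundary:
near each boundary point `x`, and for a suitable unit vector `e`, the set `Ω` is the part of space
lying strictly below the graph, in direction `e`, of a smooth function of the variables
orthogonal to `e` (that is, of a smooth function `φ` on `ℝᴺ` which is constant along `e`). In
dimension one these are exactly the bounded open intervals. -/
structure IsSmoothBoundedDomain {N : ℕ} (Ω : Set (EuclideanSpace ℝ (Fin N))) : Prop where
  isOpen : IsOpen Ω
  isConnected : IsConnected Ω
  isBounded : Bornology.IsBounded Ω
  smooth_boundary : ∀ x ∈ frontier Ω, ∃ (e : EuclideanSpace ℝ (Fin N))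
    (φ : EuclideanSpace ℝ (Fin N) → ℝ), ‖e‖ = 1 ∧ ContDiff ℝ ∞ φ ∧
      (∀ (y : EuclideanSpace ℝ (Fin N)) (t : ℝ), φ (y + t • e) = φ y) ∧
      ∀ᶠ y in 𝓝 x, (y ∈ Ω ↔ inner ℝ e y < φ y)

/-- `ν` is the outward unit normal of `Ω` at `x`: the normalized gradient at `x` of a smooth
function `ρ` with nonzero gradient at `x` such that `Ω` is the set `ρ < 0` near `x`. -/
def IsOutwardUnitNormal {N : ℕ} (Ω : Set (EuclideanSpace ℝ (Fin N)))
    (x ν : EuclideanSpace ℝ (Fin N)) : Prop :=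
  ∃ ρ : EuclideanSpace ℝ (Fin N) → ℝ, ContDiff ℝ ∞ ρ ∧ gradient ρ x ≠ 0 ∧
    (∀ᶠ y in 𝓝 x, (y ∈ Ω ↔ ρ y < 0)) ∧ ν = ‖gradient ρ x‖⁻¹ • gradient ρ x

/-- The homogeneous Neumann condition `∂_ν w = 0` on `∂Ω`, for `w` of class `C¹` on the closure
of `Ω`; the derivative of `w` at a boundary point is the one taken within the closure. -/
def NeumannCondition {N : ℕ} (Ω : Set (EuclideanSpace ℝ (Fin N)))
    (w : EuclideanSpace ℝ (Fin N) → ℝ) : Prop :=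
  ∀ x ∈ frontier Ω, ∀ ν, IsOutwardUnitNormal Ω x ν → fderivWithin ℝ w (closure Ω) x ν = 0

/-- The reaction term `f(u,v) = u (a₁ - b₁ u - c₁ v)`. -/
def reactF (a₁ b₁ c₁ u v : ℝ) : ℝ := u * (a₁ - b₁ * u - c₁ * v)

/-- The reaction term `g(u,v) = v (a₂ - b₂ u - c₂ v)`. -/
def reactG (a₂ b₂ c₂ u v : ℝ) : ℝ := v * (a₂ - b₂ * u - c₂ * v)

/-- `u(w,τ)`, the positive solution `u` of `w = δ u - γ τ / u`. -/
def uOf (γ δ w τ : ℝ) : ℝ := (√(w ^ 2 + 4 * γ * δ * τ) + w) / (2 * δ)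

/-- `v(w,τ)`, equal to `τ / u(w,τ)`. -/
def vOf (γ δ w τ : ℝ) : ℝ := (√(w ^ 2 + 4 * γ * δ * τ) - w) / (2 * γ)

theorem uOf_pos {γ δ w τ : ℝ} (hγ : 0 < γ) (hδ : 0 < δ) (hτ : 0 < τ) : 0 < uOf γ δ w τ := by
  have h : |w| < √(w ^ 2 + 4 * γ * δ * τ) := by
    rw [← Real.sqrt_sq_eq_abs]
    exact Real.sqrt_lt_sqrt (sq_nonneg w) (by have : 0 < 4 * γ * δ * τ := by positivity
                                              linarith)
  have h2 : 0 < √(w ^ 2 + 4 * γ * δ * τ) + w := by linarith [neg_abs_le w]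
  unfold uOf
  positivity

theorem vOf_eq {γ δ w τ : ℝ} (hγ : 0 < γ) (hδ : 0 < δ) (hτ : 0 < τ) :
    vOf γ δ w τ = τ / uOf γ δ w τ := by
  rw [eq_div_iff (uOf_pos hγ hδ hτ).ne']
  have h : √(w ^ 2 + 4 * γ * δ * τ) ^ 2 = w ^ 2 + 4 * γ * δ * τ :=
    Real.sq_sqrt (by positivity)
  unfold uOf vOf
  field_simp
  linear_combination h

/-- `(w,τ)` is a (classical) solution of the limiting system on `Ω` with parameter `d`:
`w ∈ C²(closure Ω)`, `τ > 0`, `d Δw + f(u,v) - γ g(u,v) = 0` in `Ω`, `∂_ν w = 0` on `∂Ω` and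
`∫_Ω f(u,v) = 0`, where `u = u(w,τ)` and `v = v(w,τ)`. -/
structure IsSolution (a₁ a₂ b₁ b₂ c₁ c₂ γ δ : ℝ) {N : ℕ} (Ω : Set (EuclideanSpace ℝ (Fin N)))
    (d : ℝ) (w : EuclideanSpace ℝ (Fin N) → ℝ) (τ : ℝ) : Prop where
  contDiffOn : ContDiffOn ℝ 2 w (closure Ω)
  tau_pos : 0 < τ
  equation : ∀ x ∈ Ω, d * Laplacian.laplacian w x
      + reactF a₁ b₁ c₁ (uOf γ δ (w x) τ) (vOf γ δ (w x) τ)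
      - γ * reactG a₂ b₂ c₂ (uOf γ δ (w x) τ) (vOf γ δ (w x) τ) = 0
  neumann : NeumannCondition Ω w
  constraint : ∫ x in Ω, reactF a₁ b₁ c₁ (uOf γ δ (w x) τ) (vOf γ δ (w x) τ) = 0

/-- A nonconstant solution: a solution `(w,τ)` such that `w` is not constant on `closure Ω`. -/
def IsNonconstantSolution (a₁ a₂ b₁ b₂ c₁ c₂ γ δ : ℝ) {N : ℕ}
    (Ω : Set (EuclideanSpace ℝ (Fin N))) (d : ℝ)
    (w : EuclideanSpace ℝ (Fin N) → ℝ) (τ : ℝ) : Prop :=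
  IsSolution a₁ a₂ b₁ b₂ c₁ c₂ γ δ Ω d w τ ∧ ¬ ∃ k : ℝ, ∀ x ∈ closure Ω, w x = k

end FullCross

end

/-!
Write the equation as `d Δw + H(w) = 0` with `H = f - γ g`, and recall `u v = τ`, `δ u - γ v = w`.

*Green's identity.* Everything integral rests on `∫ (ψ Δw + ∇ψ ⬝ ∇w) = 0` over `Ω`, valid when
`∂_ν w = 0` (`IsSmoothBoundedDomain.integral_divGrad`). Only the case of zero flux is needed, so no
surface measure is used: near the boundary, where `Ω = {ρ < 0}`, the test function is
multiplied by a cut-off `χ(-n ρ)`. The error term contains `n χ'(-n ρ) ∇ρ ⬝ ∇w`, which is bounded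
because `∇ρ ⬝ ∇w = O(ρ)` by the Neumann condition, and it tends to zero pointwise.

*Bounds.* Taking `ψ = 1` gives `∫ g = ∫ f = 0`. Since `f ≤ a₁² / (4 b₁) - c₁ τ` and
`g ≤ a₂² / (4 c₂) - b₂ τ` pointwise, both bounds on `τ` follow. At a maximum of `w` on the closure,
`Δw ≤ 0`, hence `H(w) ≥ 0` there, which bounds `w` from above; a minimum is treated likewise. At
boundary points no Hopf lemma is needed because `w` is `C²` up to the boundary
(`IsSmoothBoundedDomain.closureLaplacian_nonpos`).

*Constancy.* Testing with `w - m`, where `m` is the mean of `w`, gives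
`d ∫ |∇w|² = ∫ (H(w) - H(m)) (w - m) ≤ L ∫ (w - m)²`, where the one-sided Lipschitz constant
`L = a₁ / δ + a₂` does not depend on `τ` (`reactH_sub_mul_le`). By the Poincaré inequality
(`IsSmoothBoundedDomain.exists_poincare`) the right-hand side is at most `L C ∫ |∇w|²`, so `w = m`
once `d > L C`. The Poincaré inequality is obtained from a translation estimate on small sets with
the interior cone property, and by chaining these sets along the connected set `Ω`.
-/

namespace FullCross

/-! ### Geometry of smooth bounded domains -/

section Geometry

variable {N : ℕ} {Ω : Set (EuclideanSpace ℝ (Fin N))} {x : EuclideanSpace ℝ (Fin N)}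

/-- A boundary chart at `x`: in the ball of radius `r` around `x` the set `Ω` is `ρ < 0`, where the
smooth function `ρ` has unit slope along the unit vector `e`. -/
structure IsBoundaryChart (Ω : Set (EuclideanSpace ℝ (Fin N))) (x e : EuclideanSpace ℝ (Fin N))
    (ρ : EuclideanSpace ℝ (Fin N) → ℝ) (r : ℝ) : Prop where
  norm_eq : ‖e‖ = 1
  contDiff : ContDiff ℝ ∞ ρ
  add_smul : ∀ (y : EuclideanSpace ℝ (Fin N)) (t : ℝ), ρ (y + t • e) = ρ y + t
  pos : 0 < r
  mem_iff : ∀ y ∈ Metric.ball x r, (y ∈ Ω ↔ ρ y < 0)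

theorem IsSmoothBoundedDomain.exists_chart (hΩ : IsSmoothBoundedDomain Ω)
    (hx : x ∈ frontier Ω) : ∃ e ρ r, IsBoundaryChart Ω x e ρ r := by
  obtain ⟨e, φ, he, hφ, hinv, hev⟩ := hΩ.smooth_boundary x hx
  obtain ⟨r, hr, hball⟩ := Metric.eventually_nhds_iff_ball.1 hev
  refine ⟨e, fun y => inner ℝ e y - φ y, r, he, ?_, ?_, hr, ?_⟩
  · exact (contDiff_const.inner ℝ contDiff_id).sub hφ
  · intro y t
    simp only [hinv, inner_add_right, inner_smul_right, real_inner_self_eq_norm_sq, he]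
    ring
  · intro y hy
    rw [hball y hy, sub_neg]

namespace IsBoundaryChart

variable {e : EuclideanSpace ℝ (Fin N)} {ρ : EuclideanSpace ℝ (Fin N) → ℝ} {r : ℝ}

theorem differentiable (h : IsBoundaryChart Ω x e ρ r) : Differentiable ℝ ρ :=
  h.contDiff.differentiable (by simp)

theorem mono (h : IsBoundaryChart Ω x e ρ r) {r' : ℝ} (h0 : 0 < r') (hr : r' ≤ r) :
    IsBoundaryChart Ω x e ρ r' :=
  ⟨h.norm_eq, h.contDiff, h.add_smul, h0, fun y hy => h.mem_iff y (Metric.ball_subset_ball hr hy)⟩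

theorem nonpos_of_mem_closure (h : IsBoundaryChart Ω x e ρ r) {y : EuclideanSpace ℝ (Fin N)}
    (hy : y ∈ closure Ω) (hyr : y ∈ Metric.ball x r) : ρ y ≤ 0 := by
  have h1 : y ∈ closure (Metric.ball x r ∩ Ω) :=
    Metric.isOpen_ball.inter_closure ⟨hyr, hy⟩
  have h2 : closure (Metric.ball x r ∩ Ω) ⊆ {y | ρ y ≤ 0} :=
    closure_minimal (fun z hz => ((h.mem_iff z hz.1).1 hz.2).le)
      (isClosed_le h.contDiff.continuous continuous_const)
  exact h2 h1

theorem eq_zero_of_mem_frontier (h : IsBoundaryChart Ω x e ρ r) (hΩ : IsOpen Ω)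
    {y : EuclideanSpace ℝ (Fin N)} (hy : y ∈ frontier Ω) (hyr : y ∈ Metric.ball x r) :
    ρ y = 0 := by
  rw [hΩ.frontier_eq] at hy
  refine le_antisymm (h.nonpos_of_mem_closure hy.1 hyr) (not_lt.1 fun hlt => hy.2 ?_)
  exact (h.mem_iff y hyr).2 hlt

theorem fderiv_add_smul (h : IsBoundaryChart Ω x e ρ r) (y : EuclideanSpace ℝ (Fin N)) (t : ℝ) :
    fderiv ℝ ρ (y + t • e) = fderiv ℝ ρ y := by
  rw [← fderiv_comp_add_right (f := ρ) (t • e)]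
  have : (fun z => ρ (z + t • e)) = fun z => ρ z + t := funext fun z => h.add_smul z t
  rw [this, fderiv_add_const]

theorem fderiv_apply_self (h : IsBoundaryChart Ω x e ρ r) (y : EuclideanSpace ℝ (Fin N)) :
    fderiv ℝ ρ y e = 1 := by
  rw [← (h.differentiable y).lineDeriv_eq_fderiv]
  have h1 : HasLineDerivAt ℝ ρ 1 y e := by
    unfold HasLineDerivAt
    simp only [h.add_smul]
    exact (hasDerivAt_id 0).const_add _
  exact h1.lineDeriv

/-- The Neumann condition says that the derivative along the gradient of a local defining function
vanishes. -/
theorem fderivWithin_gradient (h : IsBoundaryChart Ω x e ρ r)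
    {w : EuclideanSpace ℝ (Fin N) → ℝ} (hw : NeumannCondition Ω w)
    {y : EuclideanSpace ℝ (Fin N)} (hy : y ∈ frontier Ω) (hyr : y ∈ Metric.ball x r) :
    fderivWithin ℝ w (closure Ω) y (gradient ρ y) = 0 := by
  have hne : gradient ρ y ≠ 0 := by
    intro h0
    have h1 : inner ℝ (gradient ρ y) e = fderiv ℝ ρ y e := by simp [gradient]
    rw [h.fderiv_apply_self, h0, inner_zero_left] at h1
    exact zero_ne_one h1
  have h1 := hw y hy _ ⟨ρ, h.contDiff, hne,
    Filter.mem_of_superset (Metric.isOpen_ball.mem_nhds hyr) h.mem_iff, rfl⟩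
  rw [map_smul, smul_eq_mul, mul_eq_zero] at h1
  exact h1.resolve_left (inv_ne_zero (norm_ne_zero_iff.2 hne))

theorem eventually_mem (h : IsBoundaryChart Ω x e ρ r) (hΩ : IsOpen Ω) (hx : x ∈ frontier Ω)
    {v : EuclideanSpace ℝ (Fin N)} (hv : fderiv ℝ ρ x v < 0) :
    ∀ᶠ t : ℝ in 𝓝[>] 0, x + t • v ∈ Ω := by
  have h0 : ρ x = 0 := h.eq_zero_of_mem_frontier hΩ hx (Metric.mem_ball_self h.pos)
  have hd : HasDerivAt (fun t : ℝ => ρ (x + t • v)) (fderiv ℝ ρ x v) 0 :=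
    (h.differentiable x).hasFDerivAt.hasLineDerivAt v
  have h1 := (hasDerivWithinAt_iff_tendsto_slope' (s := Ioi 0) (by simp)).1
    (hd.hasDerivWithinAt (s := Ioi 0))
  have h2 := h1.eventually (Iio_mem_nhds hv)
  have hc : ContinuousAt (fun t : ℝ => x + t • v) 0 := by fun_prop
  have h3 : ∀ᶠ t : ℝ in 𝓝[>] 0, x + t • v ∈ Metric.ball x r := by
    refine (hc.tendsto.mono_left nhdsWithin_le_nhds).eventually ?_
    rw [zero_smul, add_zero]
    exact Metric.ball_mem_nhds x h.pos
  filter_upwards [h2, h3, self_mem_nhdsWithin] with t ht htb htpos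
  rw [h.mem_iff _ htb]
  simp only [slope_def_field, zero_smul, add_zero, h0, sub_zero] at ht
  have ht0 : (0 : ℝ) < t := htpos
  rcases div_neg_iff.1 ht with h' | h'
  · linarith [h'.2]
  · exact h'.1

end IsBoundaryChart

/-- The uniform interior cone property, in a form which also holds at interior points (where one
may take `p = 0`): displacements close to `p` move points of the closure near `x` into `Ω`. -/
theorem IsSmoothBoundedDomain.exists_cone (hΩ : IsSmoothBoundedDomain Ω) (hx : x ∈ closure Ω) :
    ∃ (p : EuclideanSpace ℝ (Fin N)) (r : ℝ), 0 < r ∧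
      ∀ a ∈ closure Ω ∩ Metric.ball x r, ∀ z ∈ Metric.ball p (2 * r), ∀ t ∈ Ioc (0 : ℝ) 1,
        a + t • z ∈ Ω := by
  by_cases hxΩ : x ∈ Ω
  · obtain ⟨R, hR, hball⟩ := Metric.isOpen_iff.1 hΩ.isOpen x hxΩ
    refine ⟨0, R / 3, by positivity, fun a ha z hz t ht => hball ?_⟩
    have ha2 := ha.2
    rw [mem_ball_iff_norm] at ha2 hz ⊢
    rw [sub_zero] at hz
    have h1 : ‖t • z‖ ≤ ‖z‖ := by
      rw [norm_smul, Real.norm_of_nonneg ht.1.le]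
      exact mul_le_of_le_one_left (norm_nonneg _) ht.2
    calc ‖a + t • z - x‖ = ‖(a - x) + t • z‖ := by congr 1; abel
      _ ≤ ‖a - x‖ + ‖t • z‖ := norm_add_le _ _
      _ < R := by linarith
  · have hxf : x ∈ frontier Ω := by rw [hΩ.isOpen.frontier_eq]; exact ⟨hx, hxΩ⟩
    obtain ⟨e, ρ, R₁, hc⟩ := hΩ.exists_chart hxf
    obtain ⟨K, U, hU, hK⟩ := ((hc.contDiff.of_le (m := 1) (by simp)).contDiffAt
      (x := x)).exists_lipschitzOnWith
    obtain ⟨R₂, hR₂, hball⟩ := Metric.mem_nhds_iff.1 hU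
    set R := min R₁ R₂ with hRdef
    have hR : 0 < R := lt_min hc.pos hR₂
    have hK0 : (0 : ℝ) ≤ K := K.2
    set r := R / (2 * K + 4) with hrdef
    have hr : 0 < r := by positivity
    have hrR : r * (2 * K + 4) = R := by rw [hrdef]; field_simp
    set s := 2 * r * K + r with hs
    have hs0 : 0 < s := by positivity
    refine ⟨-(s • e), r, hr, fun a ha z hz t ht => ?_⟩
    have ha2 := ha.2
    obtain ⟨ζ, rfl⟩ : ∃ ζ, z = -(s • e) + ζ := ⟨z + s • e, by abel⟩
    rw [mem_ball_iff_norm] at ha2 hz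
    rw [add_sub_cancel_left] at hz
    have e1 : a + t • (-(s • e) + ζ) = (a + t • ζ) + (-(t * s)) • e := by
      simp only [smul_add, smul_neg, smul_smul, neg_smul]; abel
    have htζ : ‖t • ζ‖ ≤ t * (2 * r) := by
      rw [norm_smul, Real.norm_of_nonneg ht.1.le]
      exact mul_le_mul_of_nonneg_left hz.le ht.1.le
    have htζ' : ‖t • ζ‖ ≤ 2 * r := htζ.trans (mul_le_of_le_one_left (by positivity) ht.2)
    have hts : t * s ≤ s := mul_le_of_le_one_left hs0.le ht.2
    have hb1 : a + t • ζ ∈ Metric.ball x R := by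
      rw [mem_ball_iff_norm]
      calc ‖a + t • ζ - x‖ = ‖(a - x) + t • ζ‖ := by congr 1; abel
        _ ≤ ‖a - x‖ + ‖t • ζ‖ := norm_add_le _ _
        _ < R := by nlinarith
    have hb2 : a + t • (-(s • e) + ζ) ∈ Metric.ball x R := by
      rw [e1, mem_ball_iff_norm]
      have h3 : ‖(-(t * s)) • e‖ = t * s := by
        rw [norm_smul, hc.norm_eq, mul_one, norm_neg, Real.norm_of_nonneg (by nlinarith [ht.1])]
      calc ‖a + t • ζ + (-(t * s)) • e - x‖ = ‖(a - x) + t • ζ + (-(t * s)) • e‖ := by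
            congr 1; abel
        _ ≤ ‖a - x‖ + ‖t • ζ‖ + ‖(-(t * s)) • e‖ := norm_add₃_le
        _ < R := by rw [h3]; nlinarith
    have hba : a ∈ Metric.ball x R := by
      rw [mem_ball_iff_norm]; nlinarith
    have hRle1 : R ≤ R₁ := min_le_left _ _
    have hRle2 : R ≤ R₂ := min_le_right _ _
    rw [hc.mem_iff _ (Metric.ball_subset_ball hRle1 hb2), e1, hc.add_smul]
    have h4 := hc.nonpos_of_mem_closure ha.1 (Metric.ball_subset_ball hRle1 hba)
    have h5 := hK.dist_le_mul _ (hball (Metric.ball_subset_ball hRle2 hb1)) _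
      (hball (Metric.ball_subset_ball hRle2 hba))
    rw [Real.dist_eq, dist_eq_norm, add_sub_cancel_left] at h5
    have h6 := (le_abs_self _).trans h5
    have h7 : (K : ℝ) * ‖t • ζ‖ ≤ K * (t * (2 * r)) := mul_le_mul_of_nonneg_left htζ hK0
    have h8 : 0 < t * r := mul_pos ht.1 hr
    nlinarith

theorem IsSmoothBoundedDomain.uniqueDiffOn_closure (hΩ : IsSmoothBoundedDomain Ω) :
    UniqueDiffOn ℝ (closure Ω) := by
  intro x hx
  obtain ⟨p, r, hr, h⟩ := hΩ.exists_cone hx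
  have hsub : convexJoin ℝ {x} (Metric.ball (x + p) (2 * r)) ⊆ closure Ω := by
    rw [convexJoin_singleton_left]
    intro y hy
    simp only [mem_iUnion] at hy
    obtain ⟨q, hq, hy⟩ := hy
    rw [segment_eq_image'] at hy
    obtain ⟨t, ht, rfl⟩ := hy
    rcases ht.1.eq_or_lt with h0 | h0
    · simpa [← h0] using hx
    · refine subset_closure (h x ⟨hx, Metric.mem_ball_self hr⟩ (q - x) ?_ t ⟨h0, ht.2⟩)
      rw [mem_ball_iff_norm] at hq ⊢
      rwa [sub_sub]
  have hconv : Convex ℝ (convexJoin ℝ {x} (Metric.ball (x + p) (2 * r))) :=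
    (convex_singleton x).convexJoin (convex_ball _ _)
  have hsub2 : Metric.ball (x + p) (2 * r) ⊆ convexJoin ℝ {x} (Metric.ball (x + p) (2 * r)) :=
    subset_convexJoin_right (singleton_nonempty x)
  refine (uniqueDiffWithinAt_convex hconv ?_ ?_).mono hsub
  · exact ⟨x + p, interior_maximal hsub2 Metric.isOpen_ball (Metric.mem_ball_self (by positivity))⟩
  · exact subset_closure (subset_convexJoin_left
      ⟨x + p, Metric.mem_ball_self (by positivity)⟩ (mem_singleton x))

theorem IsSmoothBoundedDomain.isCompact_closure (hΩ : IsSmoothBoundedDomain Ω) :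
    IsCompact (closure Ω) :=
  hΩ.isBounded.isCompact_closure

end Geometry

/-! ### Derivatives up to the boundary -/

section Closure

variable {N : ℕ} {Ω : Set (EuclideanSpace ℝ (Fin N))} {x : EuclideanSpace ℝ (Fin N)}
  {w ψ : EuclideanSpace ℝ (Fin N) → ℝ}

theorem closure_mem_nhds (hΩ : IsOpen Ω) (hx : x ∈ Ω) : closure Ω ∈ 𝓝 x :=
  mem_of_superset (hΩ.mem_nhds hx) subset_closure

theorem fderivWithin_closure_eq (hΩ : IsOpen Ω) (hx : x ∈ Ω)
    (w : EuclideanSpace ℝ (Fin N) → ℝ) :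
    fderivWithin ℝ w (closure Ω) x = fderiv ℝ w x :=
  fderivWithin_of_mem_nhds (closure_mem_nhds hΩ hx)

theorem laplacian_eq_sum (w : EuclideanSpace ℝ (Fin N) → ℝ) (x : EuclideanSpace ℝ (Fin N)) :
    Laplacian.laplacian w x = ∑ i, fderiv ℝ (fderiv ℝ w) x (EuclideanSpace.basisFun (Fin N) ℝ i)
      (EuclideanSpace.basisFun (Fin N) ℝ i) := by
  rw [InnerProductSpace.laplacian_eq_iteratedFDeriv_orthonormalBasis w
    (EuclideanSpace.basisFun (Fin N) ℝ)]
  simp [iteratedFDeriv_two_apply]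

/-- The trace of the second derivative within the closure of `Ω`: the continuous extension of
the Laplacian to the closure. -/
noncomputable def closureLaplacian (Ω : Set (EuclideanSpace ℝ (Fin N)))
    (w : EuclideanSpace ℝ (Fin N) → ℝ) (x : EuclideanSpace ℝ (Fin N)) : ℝ :=
  ∑ i, fderivWithin ℝ (fderivWithin ℝ w (closure Ω)) (closure Ω) x
    (EuclideanSpace.basisFun (Fin N) ℝ i) (EuclideanSpace.basisFun (Fin N) ℝ i)

theorem closureLaplacian_eq (hΩ : IsOpen Ω) (hx : x ∈ Ω) (w : EuclideanSpace ℝ (Fin N) → ℝ) :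
    closureLaplacian Ω w x = Laplacian.laplacian w x := by
  have h : fderivWithin ℝ w (closure Ω) =ᶠ[𝓝 x] fderiv ℝ w := by
    filter_upwards [hΩ.mem_nhds hx] with y hy using fderivWithin_closure_eq hΩ hy w
  rw [laplacian_eq_sum, closureLaplacian,
    fderivWithin_of_mem_nhds (closure_mem_nhds hΩ hx), h.fderiv_eq]

theorem IsSmoothBoundedDomain.contDiffOn_fderivWithin (hΩ : IsSmoothBoundedDomain Ω)
    (hw : ContDiffOn ℝ 2 w (closure Ω)) :
    ContDiffOn ℝ 1 (fderivWithin ℝ w (closure Ω)) (closure Ω) :=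
  hw.fderivWithin hΩ.uniqueDiffOn_closure (by norm_num [one_add_one_eq_two])

theorem IsSmoothBoundedDomain.continuousOn_closureLaplacian (hΩ : IsSmoothBoundedDomain Ω)
    (hw : ContDiffOn ℝ 2 w (closure Ω)) : ContinuousOn (closureLaplacian Ω w) (closure Ω) := by
  have h := (hΩ.contDiffOn_fderivWithin hw).continuousOn_fderivWithin
    hΩ.uniqueDiffOn_closure le_rfl
  unfold closureLaplacian
  fun_prop

end Closure

/-! ### Green's identity under the Neumann condition -/

section Green

variable {N : ℕ} {Ω : Set (EuclideanSpace ℝ (Fin N))} {x : EuclideanSpace ℝ (Fin N)}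
  {w ψ φ : EuclideanSpace ℝ (Fin N) → ℝ}

/-- The divergence `ψ Δw + ∇ψ ⬝ ∇w` of the vector field `ψ ∇w`. -/
noncomputable def divGrad (ψ w : EuclideanSpace ℝ (Fin N) → ℝ) (x : EuclideanSpace ℝ (Fin N)) : ℝ :=
  ψ x * Laplacian.laplacian w x + fderiv ℝ w x (gradient ψ x)

theorem fderiv_apply_gradient (ψ w : EuclideanSpace ℝ (Fin N) → ℝ)
    (x : EuclideanSpace ℝ (Fin N)) :
    fderiv ℝ w x (gradient ψ x) = ∑ i, fderiv ℝ ψ x (EuclideanSpace.basisFun (Fin N) ℝ i)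
      * fderiv ℝ w x (EuclideanSpace.basisFun (Fin N) ℝ i) := by
  conv_lhs => rw [← (EuclideanSpace.basisFun (Fin N) ℝ).sum_repr' (gradient ψ x)]
  rw [map_sum]
  refine Finset.sum_congr rfl fun i _ => ?_
  rw [map_smul, smul_eq_mul, real_inner_comm]
  simp [gradient]

theorem divGrad_congr (h : φ =ᶠ[𝓝 x] ψ) (w : EuclideanSpace ℝ (Fin N) → ℝ) :
    divGrad φ w x = divGrad ψ w x := by
  simp only [divGrad, gradient, h.fderiv_eq, h.eq_of_nhds]

theorem gradient_mul (hφ : DifferentiableAt ℝ φ x) (hψ : DifferentiableAt ℝ ψ x) :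
    gradient (fun y => φ y * ψ y) x = φ x • gradient ψ x + ψ x • gradient φ x := by
  simp only [gradient]
  rw [fderiv_fun_mul hφ hψ]
  simp

theorem divGrad_mul (hφ : DifferentiableAt ℝ φ x) (hψ : DifferentiableAt ℝ ψ x)
    (w : EuclideanSpace ℝ (Fin N) → ℝ) :
    divGrad (fun y => φ y * ψ y) w x
      = φ x * divGrad ψ w x + ψ x * fderiv ℝ w x (gradient φ x) := by
  simp only [divGrad, gradient_mul hφ hψ, map_add, map_smul, smul_eq_mul]
  ring

theorem divGrad_sum {ι : Type*} (s : Finset ι) {ψ : ι → EuclideanSpace ℝ (Fin N) → ℝ}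
    (h : ∀ i ∈ s, DifferentiableAt ℝ (ψ i) x) (w : EuclideanSpace ℝ (Fin N) → ℝ) :
    divGrad (fun y => ∑ i ∈ s, ψ i y) w x = ∑ i ∈ s, divGrad (ψ i) w x := by
  simp only [divGrad, gradient]
  rw [fderiv_fun_sum h, map_sum, map_sum, Finset.sum_mul, Finset.sum_add_distrib]

theorem contDiffAt_of_closure {n : WithTop ℕ∞} (hΩ : IsOpen Ω) (hx : x ∈ Ω)
    (hψ : ContDiffOn ℝ n ψ (closure Ω)) : ContDiffAt ℝ n ψ x :=
  hψ.contDiffAt (closure_mem_nhds hΩ hx)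

/-- The integral of the divergence of a compactly supported `C¹` field vanishes. -/
theorem integral_divGrad_of_hasCompactSupport (hΩ : IsOpen Ω) (hw : ContDiffOn ℝ 2 w Ω)
    (hψ : ContDiff ℝ 1 ψ) (hc : HasCompactSupport ψ) (hs : tsupport ψ ⊆ Ω) :
    ∫ y in Ω, divGrad ψ w y = 0 := by
  set b := EuclideanSpace.basisFun (Fin N) ℝ with hb
  let g : Fin N → EuclideanSpace ℝ (Fin N) → ℝ := fun i y => ψ y * fderiv ℝ w y (b i)
  have hfw : ∀ y ∈ Ω, ContDiffAt ℝ 1 (fderiv ℝ w) y := fun y hy =>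
    (hw.contDiffAt (hΩ.mem_nhds hy)).fderiv_right (m := 1) (by norm_num [one_add_one_eq_two])
  have hg : ∀ i, ContDiff ℝ 1 (g i) := fun i => by
    rw [contDiff_iff_contDiffAt]
    intro y
    by_cases hy : y ∈ Ω
    · exact hψ.contDiffAt.mul ((hfw y hy).clm_apply contDiffAt_const)
    · have h0 : ψ =ᶠ[𝓝 y] 0 := notMem_tsupport_iff_eventuallyEq.1 fun h => hy (hs h)
      refine (contDiffAt_const (c := (0 : ℝ))).congr_of_eventuallyEq ?_
      filter_upwards [h0] with z hz
      simp [g, hz]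
  have hgc : ∀ i, HasCompactSupport (g i) := fun i => hc.mul_right
  have hgi : ∀ i, Integrable (fun y => fderiv ℝ (g i) y (b i)) := fun i =>
    (((hg i).continuous_fderiv one_ne_zero).clm_apply
      continuous_const).integrable_of_hasCompactSupport ((hgc i).fderiv_apply ℝ (b i))
  have hg0 : ∀ i, ∫ y, fderiv ℝ (g i) y (b i) = 0 := fun i => by
    have h := integral_mul_fderiv_eq_neg_fderiv_mul_of_integrable (μ := volume)
      (f := fun _ : EuclideanSpace ℝ (Fin N) => (1 : ℝ)) (g := g i) (v := b i)
      (by simp) (by simpa using hgi i)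
      (by simpa using ((hg i).continuous.integrable_of_hasCompactSupport (hgc i)))
      (fun y _ => differentiableAt_const _) (fun y _ => (hg i).differentiable one_ne_zero y)
    simpa using h
  have heq : ∀ y ∈ Ω, divGrad ψ w y = ∑ i, fderiv ℝ (g i) y (b i) := fun y hy => by
    rw [divGrad, laplacian_eq_sum, fderiv_apply_gradient, Finset.mul_sum,
      ← Finset.sum_add_distrib]
    refine Finset.sum_congr rfl fun i _ => ?_
    have hd := (hfw y hy).differentiableAt one_ne_zero
    have hd2 : DifferentiableAt ℝ (fun z => fderiv ℝ w z (b i)) y :=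
      hd.clm_apply (differentiableAt_const _)
    have hd3 : fderiv ℝ (fun z => fderiv ℝ w z (b i)) y (b i)
        = fderiv ℝ (fderiv ℝ w) y (b i) (b i) := by
      rw [fderiv_clm_apply hd (differentiableAt_const _)]
      simp
    simp only [g]
    rw [fderiv_fun_mul (hψ.differentiable one_ne_zero y) hd2]
    simp only [add_apply, smul_apply, smul_eq_mul, hd3]
    ring
  rw [setIntegral_congr_fun hΩ.measurableSet heq, setIntegral_eq_integral_of_forall_compl_eq_zero,
    integral_finsetSum _ fun i _ => hgi i]
  · exact Finset.sum_eq_zero fun i _ => hg0 i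
  · intro y hy
    refine Finset.sum_eq_zero fun i _ => ?_
    have h0 : ψ =ᶠ[𝓝 y] 0 := notMem_tsupport_iff_eventuallyEq.1 fun h => hy (hs h)
    have h1 : g i =ᶠ[𝓝 y] fun _ => 0 := by
      filter_upwards [h0] with z hz
      simp [g, hz]
    rw [h1.fderiv_eq]
    simp

/-- `ψ ∇w` has a divergence extending continuously to the compact closure. -/
theorem IsSmoothBoundedDomain.exists_continuousOn_divGrad (hΩ : IsSmoothBoundedDomain Ω)
    (hw : ContDiffOn ℝ 2 w (closure Ω)) (hψ : ContDiffOn ℝ 1 ψ (closure Ω)) :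
    ∃ D : EuclideanSpace ℝ (Fin N) → ℝ, ContinuousOn D (closure Ω) ∧
      ∀ y ∈ Ω, D y = divGrad ψ w y := by
  have hu := hΩ.uniqueDiffOn_closure
  refine ⟨fun y => ψ y * closureLaplacian Ω w y + fderivWithin ℝ w (closure Ω) y
    ((InnerProductSpace.toDual ℝ _).symm (fderivWithin ℝ ψ (closure Ω) y)), ?_, ?_⟩
  · refine (hψ.continuousOn.mul (hΩ.continuousOn_closureLaplacian hw)).add
      ((hw.continuousOn_fderivWithin hu (by norm_num)).clm_apply ?_)
    exact (LinearIsometryEquiv.continuous _).comp_continuousOn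
      (hψ.continuousOn_fderivWithin hu le_rfl)
  · intro y hy
    simp only [divGrad, gradient, closureLaplacian_eq hΩ.isOpen hy,
      fderivWithin_closure_eq hΩ.isOpen hy]

theorem IsSmoothBoundedDomain.integrableOn_divGrad (hΩ : IsSmoothBoundedDomain Ω)
    (hw : ContDiffOn ℝ 2 w (closure Ω)) (hψ : ContDiffOn ℝ 1 ψ (closure Ω)) :
    IntegrableOn (divGrad ψ w) Ω := by
  obtain ⟨D, hD, hDeq⟩ := hΩ.exists_continuousOn_divGrad hw hψ
  exact ((hD.integrableOn_compact hΩ.isCompact_closure).mono_set subset_closure).congr_fun hDeq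
    hΩ.isOpen.measurableSet

/-- Near a boundary point, the Neumann condition makes the derivative of `w` along the gradient of
the defining function `ρ` of the order of `ρ`: follow the direction `e`, along which `∇ρ` is
constant, up to the boundary. -/
theorem IsBoundaryChart.exists_abs_fderiv_le {e : EuclideanSpace ℝ (Fin N)}
    {ρ : EuclideanSpace ℝ (Fin N) → ℝ} {r : ℝ} (h : IsBoundaryChart Ω x e ρ r)
    (hΩ : IsSmoothBoundedDomain Ω) (hx : x ∈ frontier Ω) (hw : ContDiffOn ℝ 2 w (closure Ω))
    (hN : NeumannCondition Ω w) :
    ∃ r' M : ℝ, 0 < r' ∧ r' ≤ r ∧ ∀ y ∈ Ω ∩ Metric.ball x r',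
      |fderiv ℝ w y (gradient ρ y)| ≤ M * |ρ y| := by
  set K := closure Ω with hK
  have hw' := hΩ.contDiffOn_fderivWithin hw
  obtain ⟨M₁, hM₁⟩ := hΩ.isCompact_closure.exists_bound_of_continuousOn
    (hw'.continuousOn_fderivWithin hΩ.uniqueDiffOn_closure le_rfl)
  have hgc : Continuous (gradient ρ) :=
    (LinearIsometryEquiv.continuous _).comp (h.contDiff.continuous_fderiv (by simp))
  obtain ⟨M₂, hM₂⟩ := (isCompact_closedBall x r).exists_bound_of_continuousOn hgc.continuousOn
  have hρ0 : ρ x = 0 := h.eq_zero_of_mem_frontier hΩ.isOpen hx (Metric.mem_ball_self h.pos)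
  have hr2 : 0 < r / 2 := half_pos h.pos
  have hev : ∀ᶠ y in 𝓝 x, |ρ y| < r / 2 := by
    refine (h.contDiff.continuous.abs.tendsto x).eventually (gt_mem_nhds ?_)
    simpa [hρ0] using hr2
  obtain ⟨r₁, hr₁, hball⟩ := Metric.eventually_nhds_iff_ball.1 hev
  refine ⟨min r₁ (r / 2), M₁ * M₂, lt_min hr₁ hr2, (min_le_right _ _).trans (by linarith), ?_⟩
  rintro y ⟨hyΩ, hy⟩
  have hy1 : |ρ y| < r / 2 := hball y (Metric.ball_subset_ball (min_le_left _ _) hy)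
  have hy2 : ‖y - x‖ < r / 2 :=
    mem_ball_iff_norm.1 (Metric.ball_subset_ball (min_le_right _ _) hy)
  have hyr : y ∈ Metric.ball x r := by rw [mem_ball_iff_norm]; linarith
  have hρy : ρ y < 0 := (h.mem_iff y hyr).1 hyΩ
  set s := -ρ y with hs
  have hs0 : 0 < s := by linarith
  have habs : |ρ y| = s := abs_of_neg hρy
  have hb : ∀ t ∈ Icc 0 s, y + t • e ∈ Metric.ball x r := fun t ht => by
    rw [mem_ball_iff_norm]
    calc ‖y + t • e - x‖ = ‖(y - x) + t • e‖ := by congr 1; abel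
      _ ≤ ‖y - x‖ + ‖t • e‖ := norm_add_le _ _
      _ < r := by
        rw [norm_smul, h.norm_eq, mul_one, Real.norm_of_nonneg ht.1]
        linarith [ht.2]
  have hin : ∀ t ∈ Ico 0 s, y + t • e ∈ Ω := fun t ht => by
    rw [h.mem_iff _ (hb t ⟨ht.1, ht.2.le⟩), h.add_smul]
    linarith [ht.2]
  have hcl : y + s • e ∈ K := by
    have hcont : Continuous fun t : ℝ => y + t • e := by fun_prop
    have h1 : s ∈ closure (Ico 0 s) := by
      rw [closure_Ico hs0.ne]; exact right_mem_Icc.2 hs0.le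
    exact hcont.closure_preimage_subset Ω (closure_mono (fun t ht => hin t ht) h1)
  have hfr : y + s • e ∈ frontier Ω := by
    rw [hΩ.isOpen.frontier_eq]
    refine ⟨hcl, fun hmem => ?_⟩
    have := (h.mem_iff _ (hb s ⟨hs0.le, le_rfl⟩)).1 hmem
    rw [h.add_smul] at this
    linarith
  have hseg : segment ℝ y (y + s • e) ⊆ K := by
    rw [segment_eq_image']
    rintro _ ⟨t, ht, rfl⟩
    simp only [add_sub_cancel_left, smul_smul]
    rcases ht.2.eq_or_lt with h1 | h1
    · rw [h1, one_mul]; exact hcl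
    · exact subset_closure (hin _ ⟨mul_nonneg ht.1 hs0.le, by nlinarith⟩)
  have hlip : ‖fderivWithin ℝ w K (y + s • e) - fderivWithin ℝ w K y‖ ≤ M₁ * ‖y + s • e - y‖ :=
    (convex_segment y (y + s • e)).norm_image_sub_le_of_norm_hasFDerivWithin_le
      (fun z hz => ((hw'.differentiableOn one_ne_zero z (hseg hz)).hasFDerivWithinAt.mono hseg))
      (fun z hz => hM₁ z (hseg hz)) (left_mem_segment ℝ _ _) (right_mem_segment ℝ _ _)
  have hgrad : gradient ρ (y + s • e) = gradient ρ y := by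
    simp only [gradient, h.fderiv_add_smul]
  have hzero : fderivWithin ℝ w K (y + s • e) (gradient ρ y) = 0 := by
    rw [← hgrad]
    exact h.fderivWithin_gradient hN hfr (hb s ⟨hs0.le, le_rfl⟩)
  have hM₁0 : 0 ≤ M₁ := (norm_nonneg _).trans (hM₁ y (subset_closure hyΩ))
  rw [add_sub_cancel_left, norm_smul, h.norm_eq, mul_one, Real.norm_of_nonneg hs0.le] at hlip
  rw [← fderivWithin_closure_eq hΩ.isOpen hyΩ, habs, ← abs_neg]
  calc |-fderivWithin ℝ w K y (gradient ρ y)|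
      = ‖(fderivWithin ℝ w K (y + s • e) - fderivWithin ℝ w K y) (gradient ρ y)‖ := by
        rw [sub_apply, hzero, zero_sub, Real.norm_eq_abs]
    _ ≤ ‖fderivWithin ℝ w K (y + s • e) - fderivWithin ℝ w K y‖ * ‖gradient ρ y‖ :=
        ContinuousLinearMap.le_opNorm _ _
    _ ≤ (M₁ * s) * M₂ := mul_le_mul hlip (hM₂ y (Metric.ball_subset_closedBall hyr))
        (norm_nonneg _) (by positivity)
    _ = M₁ * M₂ * s := by ring

/-- A smooth step, `0` on `(-∞, 1]` and `1` on `[2, ∞)`. -/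
noncomputable def step (t : ℝ) : ℝ := Real.smoothTransition (t - 1)

theorem contDiff_step : ContDiff ℝ ∞ step :=
  Real.smoothTransition.contDiff.comp (contDiff_id.sub contDiff_const)

theorem step_of_le {t : ℝ} (ht : t ≤ 1) : step t = 0 :=
  Real.smoothTransition.zero_of_nonpos (by linarith)

theorem step_of_ge {t : ℝ} (ht : 2 ≤ t) : step t = 1 :=
  Real.smoothTransition.one_of_one_le (by linarith)

theorem deriv_step_of_lt {t : ℝ} (ht : t < 1) : deriv step t = 0 := by
  have : step =ᶠ[𝓝 t] fun _ => 0 := by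
    filter_upwards [gt_mem_nhds ht] with s hs using step_of_le (le_of_lt hs)
  rw [this.deriv_eq, deriv_const]

theorem deriv_step_of_gt {t : ℝ} (ht : 2 < t) : deriv step t = 0 := by
  have : step =ᶠ[𝓝 t] fun _ => 1 := by
    filter_upwards [lt_mem_nhds ht] with s hs using step_of_ge (le_of_lt hs)
  rw [this.deriv_eq, deriv_const]

theorem exists_abs_deriv_step_mul_le : ∃ C, 0 ≤ C ∧ ∀ t, |deriv step t| * |t| ≤ C := by
  have hc : Continuous fun t => deriv step t * t :=
    (contDiff_step.continuous_deriv (by simp)).mul continuous_id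
  obtain ⟨C, hC⟩ := (isCompact_Icc (a := (1 : ℝ)) (b := 2)).exists_bound_of_continuousOn
    hc.continuousOn
  refine ⟨C, (norm_nonneg _).trans (hC 1 (by norm_num)), fun t => ?_⟩
  by_cases ht : t ∈ Icc (1 : ℝ) 2
  · simpa [abs_mul] using hC t ht
  · have h0 : deriv step t = 0 := by
      by_cases h1 : t < 1
      · exact deriv_step_of_lt h1
      · exact deriv_step_of_gt (not_le.1 fun h2 => ht ⟨not_lt.1 h1, h2⟩)
    rw [h0, abs_zero, zero_mul]
    exact (norm_nonneg _).trans (hC 1 (by norm_num))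

/-- A function on `Ω` vanishing off a compact subset of `Ω` extends by zero. -/
theorem integral_divGrad_of_vanishing (hΩ : IsOpen Ω) (hw : ContDiffOn ℝ 2 w Ω)
    (hψ : ContDiffOn ℝ 1 ψ Ω) {T : Set (EuclideanSpace ℝ (Fin N))} (hT : IsCompact T)
    (hTΩ : T ⊆ Ω) (h0 : ∀ y ∈ Ω \ T, ψ y = 0) : ∫ y in Ω, divGrad ψ w y = 0 := by
  have hsupp : tsupport (Ω.indicator ψ) ⊆ T := by
    refine closure_minimal (fun y hy => ?_) hT.isClosed
    by_contra hyT
    refine hy ?_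
    by_cases hyΩ : y ∈ Ω
    · rw [indicator_of_mem hyΩ, h0 y ⟨hyΩ, hyT⟩]
    · exact indicator_of_notMem hyΩ _
  have hloc : ∀ y ∈ Ω, Ω.indicator ψ =ᶠ[𝓝 y] ψ := fun y hy => by
    filter_upwards [hΩ.mem_nhds hy] with z hz using indicator_of_mem hz _
  have hcd : ContDiff ℝ 1 (Ω.indicator ψ) := by
    rw [contDiff_iff_contDiffAt]
    intro y
    by_cases hy : y ∈ Ω
    · exact (hψ.contDiffAt (hΩ.mem_nhds hy)).congr_of_eventuallyEq (hloc y hy)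
    · exact (contDiffAt_const (c := (0 : ℝ))).congr_of_eventuallyEq
        (notMem_tsupport_iff_eventuallyEq.1 fun h => hy (hTΩ (hsupp h)))
  rw [← integral_divGrad_of_hasCompactSupport hΩ hw hcd
    (hT.of_isClosed_subset (isClosed_tsupport _) hsupp) (hsupp.trans hTΩ)]
  exact setIntegral_congr_fun hΩ.measurableSet fun y hy => (divGrad_congr (hloc y hy) w).symm

/-- The identity for test functions supported near a boundary point: cut off at distance `1 / n`
from the boundary. The error term stays bounded by the Neumann condition, and tends to zero
pointwise. -/
theorem IsBoundaryChart.integral_divGrad {e : EuclideanSpace ℝ (Fin N)}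
    {ρ : EuclideanSpace ℝ (Fin N) → ℝ} {r : ℝ} (h : IsBoundaryChart Ω x e ρ r)
    (hΩ : IsSmoothBoundedDomain Ω) (hw : ContDiffOn ℝ 2 w (closure Ω)) {M : ℝ}
    (hM : ∀ y ∈ Ω ∩ Metric.ball x r, |fderiv ℝ w y (gradient ρ y)| ≤ M * |ρ y|)
    (hψ : ContDiffOn ℝ 1 ψ (closure Ω)) {S : Set (EuclideanSpace ℝ (Fin N))} (hS : IsCompact S)
    (hSr : S ⊆ Metric.ball x r) (h0 : ∀ y ∈ Ω \ S, ψ y = 0) :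
    ∫ y in Ω, divGrad ψ w y = 0 := by
  have hΩo := hΩ.isOpen
  let θ : ℕ → EuclideanSpace ℝ (Fin N) → ℝ := fun n y => step (-(n * ρ y))
  have hθ : ∀ n, ContDiff ℝ ∞ (θ n) := fun n =>
    contDiff_step.comp (contDiff_const.mul h.contDiff).neg
  have hψd : ∀ y ∈ Ω, DifferentiableAt ℝ ψ y := fun y hy =>
    (contDiffAt_of_closure hΩo hy hψ).differentiableAt one_ne_zero
  have hθd : ∀ n y, DifferentiableAt ℝ (θ n) y := fun n y => (hθ n).differentiable (by simp) y
  -- the cut-off test functions vanish off a compact subset of `Ω`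
  have hzero : ∀ n, ∫ y in Ω, divGrad (fun z => θ n z * ψ z) w y = 0 := fun n => by
    refine integral_divGrad_of_vanishing hΩo (hw.mono subset_closure)
      (((hθ n).of_le (by simp)).contDiffOn.mul (hψ.mono subset_closure))
      (T := S ∩ {y | (n : ℝ) * ρ y ≤ -1})
      (hS.inter_right (isClosed_le (continuous_const.mul h.contDiff.continuous) continuous_const))
      ?_ ?_
    · rintro y ⟨hyS, hy⟩
      rw [h.mem_iff y (hSr hyS)]
      by_contra hneg
      have h1 : (0 : ℝ) ≤ n * ρ y := mul_nonneg n.cast_nonneg (not_lt.1 hneg)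
      have h2 : (n : ℝ) * ρ y ≤ -1 := hy
      linarith
    · rintro y ⟨hyΩ, hyT⟩
      by_cases hyS : y ∈ S
      · have : ¬ (n : ℝ) * ρ y ≤ -1 := fun hle => hyT ⟨hyS, hle⟩
        simp only [θ]
        rw [step_of_le (by linarith), zero_mul]
      · rw [h0 y ⟨hyΩ, hyS⟩, mul_zero]
  have hgrad : ∀ n y, gradient (θ n) y = (-(n * deriv step (-(n * ρ y)))) • gradient ρ y :=
    fun n y => by
      have h1 : HasFDerivAt (θ n) (deriv step (-(n * ρ y)) • (-((n : ℝ) • fderiv ℝ ρ y))) y :=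
        (contDiff_step.differentiable (by simp) _).hasDerivAt.comp_hasFDerivAt y
          ((h.differentiable y).hasFDerivAt.const_mul (n : ℝ)).neg
      simp only [gradient, h1.fderiv, map_smul, map_neg, smul_neg, smul_smul, neg_smul]
      rw [mul_comm]
  have hexp : ∀ n, ∀ y ∈ Ω, divGrad (fun z => θ n z * ψ z) w y = θ n y * divGrad ψ w y
      - ψ y * (n * deriv step (-(n * ρ y)) * fderiv ℝ w y (gradient ρ y)) := fun n y hy => by
    rw [divGrad_mul (hθd n y) (hψd y hy), hgrad, map_smul, smul_eq_mul]
    ring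
  obtain ⟨D, hD, hDeq⟩ := hΩ.exists_continuousOn_divGrad hw hψ
  obtain ⟨B₁, hB₁⟩ := hΩ.isCompact_closure.exists_bound_of_continuousOn hD
  obtain ⟨B₂, hB₂⟩ := hΩ.isCompact_closure.exists_bound_of_continuousOn hψ.continuousOn
  obtain ⟨C, hC0, hC⟩ := exists_abs_deriv_step_mul_le
  have hbound : ∀ n, ∀ y ∈ Ω, ‖divGrad (fun z => θ n z * ψ z) w y‖ ≤ B₁ + B₂ * (|M| * C) :=
    fun n y hy => by
      rw [hexp n y hy]
      have hyK := subset_closure hy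
      have hB₂0 : 0 ≤ B₂ := (norm_nonneg _).trans (hB₂ y hyK)
      refine (norm_sub_le _ _).trans (add_le_add ?_ ?_)
      · rw [norm_mul, ← hDeq y hy]
        have h1 : ‖θ n y‖ ≤ 1 := (Real.norm_of_nonneg (Real.smoothTransition.nonneg _)).trans_le
          (Real.smoothTransition.le_one _)
        exact (mul_le_of_le_one_left (norm_nonneg _) h1).trans (hB₁ y hyK)
      · by_cases hyS : y ∈ S
        · rw [norm_mul]
          refine mul_le_mul (hB₂ y hyK) ?_ (norm_nonneg _) hB₂0
          have h1 := hM y ⟨hy, hSr hyS⟩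
          have h2 := hC (-(n * ρ y))
          rw [abs_neg, abs_mul, Nat.abs_cast] at h2
          rw [norm_mul, norm_mul, Real.norm_eq_abs, Real.norm_eq_abs, Real.norm_eq_abs,
            Nat.abs_cast]
          calc (n : ℝ) * |deriv step (-(n * ρ y))| * |fderiv ℝ w y (gradient ρ y)|
              ≤ n * |deriv step (-(n * ρ y))| * (|M| * |ρ y|) := by
                refine mul_le_mul_of_nonneg_left (h1.trans ?_) (by positivity)
                exact mul_le_mul_of_nonneg_right (le_abs_self M) (abs_nonneg _)
            _ = |M| * (|deriv step (-(n * ρ y))| * (n * |ρ y|)) := by ring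
            _ ≤ |M| * C := mul_le_mul_of_nonneg_left h2 (abs_nonneg _)
        · rw [h0 y ⟨hy, hyS⟩, zero_mul, norm_zero]
          positivity
  have hlim : ∀ y ∈ Ω, ∀ᶠ n : ℕ in atTop,
      divGrad (fun z => θ n z * ψ z) w y = divGrad ψ w y := fun y hy => by
    by_cases hyr : y ∈ Metric.ball x r
    · have hρ : ρ y < 0 := (h.mem_iff y hyr).1 hy
      filter_upwards [tendsto_natCast_atTop_atTop.eventually (eventually_gt_atTop (2 / -ρ y))]
        with n hn
      have h2 : 2 < -(n * ρ y) := by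
        rw [div_lt_iff₀ (by linarith)] at hn
        linarith
      rw [hexp n y hy, deriv_step_of_gt h2]
      simp only [θ, step_of_ge h2.le]
      ring
    · refine Eventually.of_forall fun n => ?_
      have h1 : ∀ᶠ z in 𝓝 y, ψ z = 0 := by
        filter_upwards [hΩo.mem_nhds hy, hS.isClosed.isOpen_compl.mem_nhds
          fun hyS => hyr (hSr hyS)] with z hz hzS using h0 z ⟨hz, hzS⟩
      refine divGrad_congr ?_ w
      filter_upwards [h1] with z hz
      rw [hz, mul_zero]
  have hconv : Tendsto (fun n : ℕ => ∫ y in Ω, divGrad (fun z => θ n z * ψ z) w y) atTop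
      (𝓝 (∫ y in Ω, divGrad ψ w y)) := by
    have hfin : IsFiniteMeasure (volume.restrict Ω) :=
      ⟨by rw [Measure.restrict_apply_univ]; exact hΩ.isBounded.measure_lt_top⟩
    refine tendsto_integral_of_dominated_convergence (fun _ => B₁ + B₂ * (|M| * C)) ?_
      (integrable_const _) ?_ ?_
    · exact fun n => (hΩ.integrableOn_divGrad hw
        (((hθ n).of_le (by simp)).contDiffOn.mul hψ)).aestronglyMeasurable
    · exact fun n => (ae_restrict_iff' hΩo.measurableSet).2 (Eventually.of_forall (hbound n))
    · exact (ae_restrict_iff' hΩo.measurableSet).2 (Eventually.of_forall fun y hy =>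
        tendsto_const_nhds.congr' ((hlim y hy).mono fun n hn => hn.symm))
  simp only [hzero] at hconv
  exact (tendsto_nhds_unique hconv tendsto_const_nhds)

theorem IsSmoothBoundedDomain.exists_local_integral_divGrad (hΩ : IsSmoothBoundedDomain Ω)
    (hw : ContDiffOn ℝ 2 w (closure Ω)) (hN : NeumannCondition Ω w) (hx : x ∈ closure Ω) :
    ∃ r : ℝ, 0 < r ∧ ∀ ψ : EuclideanSpace ℝ (Fin N) → ℝ, ContDiffOn ℝ 1 ψ (closure Ω) →
      (∀ y ∉ Metric.closedBall x r, ψ y = 0) → ∫ y in Ω, divGrad ψ w y = 0 := by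
  by_cases hxΩ : x ∈ Ω
  · obtain ⟨R, hR, hball⟩ := Metric.isOpen_iff.1 hΩ.isOpen x hxΩ
    refine ⟨R / 2, half_pos hR, fun ψ hψ h0 => ?_⟩
    exact integral_divGrad_of_vanishing hΩ.isOpen (hw.mono subset_closure)
      (hψ.mono subset_closure) (isCompact_closedBall x (R / 2))
      ((Metric.closedBall_subset_ball (half_lt_self hR)).trans hball) fun y hy => h0 y hy.2
  · have hxf : x ∈ frontier Ω := by rw [hΩ.isOpen.frontier_eq]; exact ⟨hx, hxΩ⟩
    obtain ⟨e, ρ, R, hc⟩ := hΩ.exists_chart hxf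
    obtain ⟨r, M, hr, hrR, hM⟩ := hc.exists_abs_fderiv_le hΩ hxf hw hN
    refine ⟨r / 2, half_pos hr, fun ψ hψ h0 => ?_⟩
    exact (hc.mono hr hrR).integral_divGrad hΩ hw hM hψ (isCompact_closedBall x (r / 2))
      (Metric.closedBall_subset_ball (half_lt_self hr)) fun y hy => h0 y hy.2

/-- Green's identity: if `∂_ν w = 0` on `∂Ω` then `∫ (ψ Δw + ∇ψ ⬝ ∇w) = 0` over `Ω`. -/
theorem IsSmoothBoundedDomain.integral_divGrad (hΩ : IsSmoothBoundedDomain Ω)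
    (hw : ContDiffOn ℝ 2 w (closure Ω)) (hN : NeumannCondition Ω w)
    (hψ : ContDiffOn ℝ 1 ψ (closure Ω)) : ∫ y in Ω, divGrad ψ w y = 0 := by
  choose! r hr hloc using fun (x : EuclideanSpace ℝ (Fin N)) (hx : x ∈ closure Ω) =>
    hΩ.exists_local_integral_divGrad hw hN hx
  obtain ⟨t, ht, hcov⟩ := hΩ.isCompact_closure.elim_nhds_subcover
    (fun x => Metric.closedBall x (r x / 2))
    (fun x hx => Metric.closedBall_mem_nhds x (half_pos (hr x hx)))
  let β : ∀ x : t, ContDiffBump x.1 := fun x =>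
    ⟨r x / 2, r x, half_pos (hr x (ht x x.2)), half_lt_self (hr x (ht x x.2))⟩
  let σ : EuclideanSpace ℝ (Fin N) → ℝ := fun y => ∑ x, β x y
  have hσ : ContDiff ℝ 1 σ := ContDiff.sum fun x _ => (β x).contDiff
  have hpos : ∀ y ∈ closure Ω, 0 < σ y := fun y hy => by
    obtain ⟨x, hx, hyx⟩ := mem_iUnion₂.1 (hcov hy)
    refine Finset.sum_pos' (fun x _ => (β x).nonneg) ⟨⟨x, hx⟩, Finset.mem_univ _, ?_⟩
    have h1 : β ⟨x, hx⟩ y = 1 := (β ⟨x, hx⟩).one_of_mem_closedBall hyx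
    rw [h1]
    exact one_pos
  let φ : t → EuclideanSpace ℝ (Fin N) → ℝ := fun x y => β x y * (ψ y / σ y)
  have hφ : ∀ x, ContDiffOn ℝ 1 (φ x) (closure Ω) := fun x =>
    (β x).contDiff.contDiffOn.mul (hψ.div hσ.contDiffOn fun y hy => (hpos y hy).ne')
  have hsum : ∀ y ∈ Ω, divGrad ψ w y = ∑ x, divGrad (φ x) w y := fun y hy => by
    rw [← divGrad_sum Finset.univ (fun x _ =>
      (contDiffAt_of_closure hΩ.isOpen hy (hφ x)).differentiableAt one_ne_zero)]
    refine divGrad_congr ?_ w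
    filter_upwards [hΩ.isOpen.mem_nhds hy] with z hz
    simp only [φ]
    rw [← Finset.sum_mul]
    exact (mul_div_cancel₀ _ (hpos z (subset_closure hz)).ne').symm
  rw [setIntegral_congr_fun hΩ.isOpen.measurableSet hsum,
    integral_finsetSum _ fun x _ => hΩ.integrableOn_divGrad hw (hφ x)]
  refine Finset.sum_eq_zero fun x _ => hloc x (ht x x.2) (φ x) (hφ x) fun y hy => ?_
  have : β x y = 0 := (β x).zero_of_le_dist (not_le.1 hy).le
  simp only [φ, this, zero_mul]

end Green

/-! ### The Poincaré inequality -/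

section Poincare

variable {N : ℕ} {Ω A B D : Set (EuclideanSpace ℝ (Fin N))} {x : EuclideanSpace ℝ (Fin N)}
  {w : EuclideanSpace ℝ (Fin N) → ℝ}

/-- The Dirichlet energy controls the quadratic oscillation of functions between `A` and `B`. Only
measurable functions are tested, which is no restriction since values off `Ω` may be changed. -/
def DiffBound (Ω A B : Set (EuclideanSpace ℝ (Fin N))) : Prop :=
  ∃ C : ℝ≥0∞, C ≠ ⊤ ∧ ∀ w : EuclideanSpace ℝ (Fin N) → ℝ, Measurable w → ContDiffOn ℝ 1 w Ω →
    ∫⁻ x in A, ∫⁻ y in B, ‖w x - w y‖ₑ ^ 2 ≤ C * ∫⁻ x in Ω, ‖fderiv ℝ w x‖ₑ ^ 2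

theorem DiffBound.symm (h : DiffBound Ω A B) : DiffBound Ω B A := by
  obtain ⟨C, hC, h⟩ := h
  refine ⟨C, hC, fun w hw hwΩ => le_of_eq_of_le ?_ (h w hw hwΩ)⟩
  rw [lintegral_lintegral_swap]
  · simp only [enorm_sub_rev]
  · exact Measurable.aemeasurable (by unfold Function.uncurry; fun_prop)

theorem DiffBound.mono_right (h : DiffBound Ω A B) (hD : D ⊆ B) : DiffBound Ω A D := by
  obtain ⟨C, hC, h⟩ := h
  exact ⟨C, hC, fun w hw hwΩ => (lintegral_mono fun x => lintegral_mono_set hD).trans (h w hw hwΩ)⟩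

theorem DiffBound.union_right (h : DiffBound Ω A B) (h' : DiffBound Ω A D) :
    DiffBound Ω A (B ∪ D) := by
  obtain ⟨C, hC, h⟩ := h
  obtain ⟨C', hC', h'⟩ := h'
  refine ⟨C + C', ENNReal.add_ne_top.2 ⟨hC, hC'⟩, fun w hw hwΩ => ?_⟩
  calc ∫⁻ x in A, ∫⁻ y in B ∪ D, ‖w x - w y‖ₑ ^ 2
      ≤ ∫⁻ x in A, ((∫⁻ y in B, ‖w x - w y‖ₑ ^ 2) + ∫⁻ y in D, ‖w x - w y‖ₑ ^ 2) :=
        lintegral_mono fun x => lintegral_union_le _ _ _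
    _ = (∫⁻ x in A, ∫⁻ y in B, ‖w x - w y‖ₑ ^ 2) + ∫⁻ x in A, ∫⁻ y in D, ‖w x - w y‖ₑ ^ 2 :=
        lintegral_add_left (Measurable.lintegral_prod_right' (ν := volume.restrict B)
          (f := fun p => ‖w p.1 - w p.2‖ₑ ^ 2) (by fun_prop)) _
    _ ≤ _ := by rw [add_mul]; exact add_le_add (h w hw hwΩ) (h' w hw hwΩ)

theorem enorm_sq_eq_ofReal (t : ℝ) : ‖t‖ₑ ^ 2 = ENNReal.ofReal (t ^ 2) := by
  rw [Real.enorm_eq_ofReal_abs, ← ENNReal.ofReal_pow (abs_nonneg t), sq_abs]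

theorem enorm_sub_sq_le (a b c : ℝ) : ‖a - c‖ₑ ^ 2 ≤ 2 * ‖a - b‖ₑ ^ 2 + 2 * ‖c - b‖ₑ ^ 2 := by
  have h2 : (2 : ℝ≥0∞) = ENNReal.ofReal 2 := by simp
  rw [enorm_sq_eq_ofReal, enorm_sq_eq_ofReal, enorm_sq_eq_ofReal, h2,
    ← ENNReal.ofReal_mul zero_le_two, ← ENNReal.ofReal_mul zero_le_two,
    ← ENNReal.ofReal_add (by positivity) (by positivity)]
  exact ENNReal.ofReal_le_ofReal (by nlinarith [sq_nonneg (a - b + (c - b))])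

/-- Oscillation bounds are transitive through an intermediate set of positive measure. -/
theorem DiffBound.trans (h : DiffBound Ω A B) (h' : DiffBound Ω D B) (hB : volume B ≠ 0)
    (hB' : volume B ≠ ⊤) (hA : volume A ≠ ⊤) (hD : volume D ≠ ⊤) : DiffBound Ω A D := by
  obtain ⟨C, hC, h⟩ := h
  obtain ⟨C', hC', h'⟩ := h'
  refine ⟨(volume B)⁻¹ * (2 * volume D * C + 2 * volume A * C'), ?_, fun w hw hwΩ => ?_⟩
  · finiteness
  set I := ∫⁻ x in Ω, ‖fderiv ℝ w x‖ₑ ^ 2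
  set a : EuclideanSpace ℝ (Fin N) → ℝ≥0∞ := fun x => ∫⁻ y in B, ‖w x - w y‖ₑ ^ 2 with ha
  have ham : Measurable a := Measurable.lintegral_prod_right' (ν := volume.restrict B)
          (f := fun p => ‖w p.1 - w p.2‖ₑ ^ 2) (by fun_prop)
  have hpt : ∀ x z, ‖w x - w z‖ₑ ^ 2 ≤ (volume B)⁻¹ * (2 * a x + 2 * a z) := fun x z => by
    rw [← ENNReal.div_eq_inv_mul, ENNReal.le_div_iff_mul_le (Or.inl hB) (Or.inl hB')]
    calc ‖w x - w z‖ₑ ^ 2 * volume B = ∫⁻ _y in B, ‖w x - w z‖ₑ ^ 2 := by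
          rw [setLIntegral_const]
      _ ≤ ∫⁻ y in B, (2 * ‖w x - w y‖ₑ ^ 2 + 2 * ‖w z - w y‖ₑ ^ 2) :=
          lintegral_mono fun y => enorm_sub_sq_le _ _ _
      _ = 2 * a x + 2 * a z := by
          rw [lintegral_add_left (by fun_prop), lintegral_const_mul _ (by fun_prop),
            lintegral_const_mul _ (by fun_prop)]
  calc ∫⁻ x in A, ∫⁻ z in D, ‖w x - w z‖ₑ ^ 2
      ≤ ∫⁻ x in A, ∫⁻ z in D, (volume B)⁻¹ * (2 * a x + 2 * a z) :=
        lintegral_mono fun x => lintegral_mono fun z => hpt x z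
    _ = ∫⁻ x in A, (volume B)⁻¹ * (2 * a x * volume D + 2 * ∫⁻ z in D, a z) := by
        refine lintegral_congr fun x => ?_
        rw [lintegral_const_mul _ (by fun_prop), lintegral_add_left (by fun_prop),
          setLIntegral_const, lintegral_const_mul _ ham]
    _ = (volume B)⁻¹ * (2 * volume D * (∫⁻ x in A, a x) + 2 * volume A * ∫⁻ z in D, a z) := by
        rw [lintegral_const_mul _ (by fun_prop), lintegral_add_left (by fun_prop),
          setLIntegral_const, lintegral_mul_const _ (by fun_prop), lintegral_const_mul _ ham]
        ring
    _ ≤ (volume B)⁻¹ * (2 * volume D * (C * I) + 2 * volume A * (C' * I)) := by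
        gcongr
        · exact h w hw hwΩ
        · exact h' w hw hwΩ
    _ = _ := by ring

theorem sq_sub_le_integral {u u' : ℝ → ℝ} (hu : ∀ t ∈ Icc (0 : ℝ) 1, HasDerivAt u (u' t) t)
    (hu' : ContinuousOn u' (Icc 0 1)) : (u 1 - u 0) ^ 2 ≤ ∫ t in (0 : ℝ)..1, u' t ^ 2 := by
  have hI : uIcc (0 : ℝ) 1 = Icc 0 1 := uIcc_of_le zero_le_one
  have h1 : ∫ t in (0 : ℝ)..1, u' t = u 1 - u 0 :=
    intervalIntegral.integral_eq_sub_of_hasDerivAt (by rwa [hI])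
      (ContinuousOn.intervalIntegrable (by rwa [hI]))
  set c := u 1 - u 0
  have h2 : 0 ≤ ∫ t in (0 : ℝ)..1, (u' t - c) ^ 2 :=
    intervalIntegral.integral_nonneg zero_le_one fun t _ => sq_nonneg _
  have h3 : ∫ t in (0 : ℝ)..1, (u' t - c) ^ 2
      = (∫ t in (0 : ℝ)..1, u' t ^ 2) - 2 * c * (∫ t in (0 : ℝ)..1, u' t) + c ^ 2 := by
    have e : ∀ t, (u' t - c) ^ 2 = u' t ^ 2 - 2 * c * u' t + c ^ 2 := fun t => by ring
    simp only [e]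
    rw [intervalIntegral.integral_add, intervalIntegral.integral_sub,
      intervalIntegral.integral_const_mul]
    · simp
    all_goals
      refine ContinuousOn.intervalIntegrable ?_
      rw [hI]
      fun_prop
  rw [h3, h1] at h2
  nlinarith

theorem enorm_sub_sq_le_lintegral_fderiv (hΩ : IsOpen Ω) (hw : ContDiffOn ℝ 1 w Ω)
    {z : EuclideanSpace ℝ (Fin N)} (hx : ∀ t ∈ Icc (0 : ℝ) 1, x + t • z ∈ Ω) :
    ‖w x - w (x + z)‖ₑ ^ 2
      ≤ ∫⁻ t in Icc (0 : ℝ) 1, ‖z‖ₑ ^ 2 * ‖fderiv ℝ w (x + t • z)‖ₑ ^ 2 := by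
  have hder : ∀ t ∈ Icc (0 : ℝ) 1,
      HasDerivAt (fun t : ℝ => w (x + t • z)) (fderiv ℝ w (x + t • z) z) t := fun t ht => by
    have h1 : HasDerivAt (fun t : ℝ => x + t • z) z t := by
      simpa using ((hasDerivAt_id t).smul_const z).const_add x
    exact ((hw.contDiffAt (hΩ.mem_nhds (hx t ht))).differentiableAt
      one_ne_zero).hasFDerivAt.comp_hasDerivAt t h1
  have hcont : ContinuousOn (fun t : ℝ => fderiv ℝ w (x + t • z) z) (Icc 0 1) := by
    have h1 : ContinuousOn (fun t : ℝ => fderiv ℝ w (x + t • z)) (Icc 0 1) :=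
      (hw.continuousOn_fderiv_of_isOpen hΩ le_rfl).comp (by fun_prop) hx
    exact h1.clm_apply continuousOn_const
  have h := sq_sub_le_integral hder hcont
  simp only [one_smul, zero_smul, add_zero] at h
  rw [intervalIntegral.integral_of_le zero_le_one, ← integral_Icc_eq_integral_Ioc] at h
  have hint : IntegrableOn (fun t : ℝ => fderiv ℝ w (x + t • z) z ^ 2) (Icc 0 1) :=
    (hcont.pow 2).integrableOn_Icc
  calc ‖w x - w (x + z)‖ₑ ^ 2 = ENNReal.ofReal ((w (x + z) - w x) ^ 2) := by
        rw [enorm_sub_rev, enorm_sq_eq_ofReal]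
    _ ≤ ENNReal.ofReal (∫ t in Icc (0 : ℝ) 1, fderiv ℝ w (x + t • z) z ^ 2) :=
        ENNReal.ofReal_le_ofReal h
    _ = ∫⁻ t in Icc (0 : ℝ) 1, ‖fderiv ℝ w (x + t • z) z‖ₑ ^ 2 := by
        rw [ofReal_integral_eq_lintegral_ofReal hint (Eventually.of_forall fun t => sq_nonneg _)]
        simp only [enorm_sq_eq_ofReal]
    _ ≤ ∫⁻ t in Icc (0 : ℝ) 1, ‖z‖ₑ ^ 2 * ‖fderiv ℝ w (x + t • z)‖ₑ ^ 2 := by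
        refine lintegral_mono fun t => ?_
        rw [← mul_pow, mul_comm]
        gcongr
        exact ContinuousLinearMap.le_opENorm _ _

/-- Translation estimate: the increment along a fixed displacement is controlled by the energy. -/
theorem lintegral_translate_le (hΩ : IsOpen Ω) (hA : MeasurableSet A) (hw : ContDiffOn ℝ 1 w Ω)
    {z : EuclideanSpace ℝ (Fin N)} (hAz : ∀ x ∈ A, ∀ t ∈ Icc (0 : ℝ) 1, x + t • z ∈ Ω) :
    ∫⁻ x in A, ‖w x - w (x + z)‖ₑ ^ 2 ≤ ‖z‖ₑ ^ 2 * ∫⁻ x in Ω, ‖fderiv ℝ w x‖ₑ ^ 2 := by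
  have hm := measurable_fderiv ℝ w
  calc ∫⁻ x in A, ‖w x - w (x + z)‖ₑ ^ 2
      ≤ ∫⁻ x in A, ∫⁻ t in Icc (0 : ℝ) 1, ‖z‖ₑ ^ 2 * ‖fderiv ℝ w (x + t • z)‖ₑ ^ 2 :=
        setLIntegral_mono' hA fun x hx => enorm_sub_sq_le_lintegral_fderiv hΩ hw (hAz x hx)
    _ = ∫⁻ t in Icc (0 : ℝ) 1, ∫⁻ x in A, ‖z‖ₑ ^ 2 * ‖fderiv ℝ w (x + t • z)‖ₑ ^ 2 := by
        refine lintegral_lintegral_swap (Measurable.aemeasurable ?_)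
        unfold Function.uncurry
        fun_prop
    _ ≤ ∫⁻ _t in Icc (0 : ℝ) 1, ‖z‖ₑ ^ 2 * ∫⁻ x in Ω, ‖fderiv ℝ w x‖ₑ ^ 2 := by
        refine setLIntegral_mono' measurableSet_Icc fun t ht => ?_
        rw [lintegral_const_mul _ (by fun_prop)]
        refine mul_le_mul' le_rfl ?_
        rw [← lintegral_indicator hA, ← lintegral_indicator hΩ.measurableSet,
          ← lintegral_add_right_eq_self (Ω.indicator fun x => ‖fderiv ℝ w x‖ₑ ^ 2) (t • z)]
        refine lintegral_mono fun x => ?_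
        by_cases hx : x ∈ A
        · rw [indicator_of_mem hx, indicator_of_mem (hAz x hx t ht)]
        · rw [indicator_of_notMem hx]
          exact zero_le
    _ = _ := by simp

theorem diffBound_of_cone (hΩ : IsOpen Ω) {p : EuclideanSpace ℝ (Fin N)} {r : ℝ}
    (h : ∀ a ∈ closure Ω ∩ Metric.ball x r, ∀ z ∈ Metric.ball p (2 * r), ∀ t ∈ Ioc (0 : ℝ) 1,
        a + t • z ∈ Ω) :
    DiffBound Ω (Metric.ball x r ∩ Ω) (Metric.ball (x + p) r) := by
  set A := Metric.ball x r ∩ Ω with hA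
  have hAm : MeasurableSet A := (Metric.isOpen_ball.inter hΩ).measurableSet
  set Z := Metric.ball p (2 * r) with hZ
  refine ⟨∫⁻ z in Z, ‖z‖ₑ ^ 2, ?_, fun w hw hwΩ => ?_⟩
  · refine ((setLIntegral_mono' (g := fun _ => (ENNReal.ofReal (‖p‖ + 2 * r)) ^ 2)
      Metric.isOpen_ball.measurableSet fun z hz => ?_).trans_lt ?_).ne
    · gcongr
      rw [← ofReal_norm]
      refine ENNReal.ofReal_le_ofReal ?_
      rw [mem_ball_iff_norm] at hz
      linarith [norm_le_norm_add_norm_sub' z p]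
    · rw [setLIntegral_const]
      exact ENNReal.mul_lt_top (by finiteness) (measure_ball_lt_top (μ := volume))
  · have hball : ∀ a ∈ A, ∫⁻ b in Metric.ball (x + p) r, ‖w a - w b‖ₑ ^ 2
        ≤ ∫⁻ z in Z, ‖w a - w (a + z)‖ₑ ^ 2 := fun a ha => by
      rw [← lintegral_indicator Metric.isOpen_ball.measurableSet,
        ← lintegral_indicator Metric.isOpen_ball.measurableSet,
        ← lintegral_add_left_eq_self _ a]
      refine lintegral_mono fun z => ?_
      by_cases hz : a + z ∈ Metric.ball (x + p) r
      · have hzZ : z ∈ Z := by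
          have ha1 := ha.1
          rw [mem_ball_iff_norm] at hz ha1 ⊢
          calc ‖z - p‖ = ‖(a + z - (x + p)) - (a - x)‖ := by congr 1; abel
            _ ≤ ‖a + z - (x + p)‖ + ‖a - x‖ := norm_sub_le _ _
            _ < 2 * r := by linarith
        rw [indicator_of_mem hz, indicator_of_mem hzZ]
      · rw [indicator_of_notMem hz]
        exact zero_le
    calc ∫⁻ a in A, ∫⁻ b in Metric.ball (x + p) r, ‖w a - w b‖ₑ ^ 2
        ≤ ∫⁻ a in A, ∫⁻ z in Z, ‖w a - w (a + z)‖ₑ ^ 2 := setLIntegral_mono' hAm hball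
      _ = ∫⁻ z in Z, ∫⁻ a in A, ‖w a - w (a + z)‖ₑ ^ 2 := by
          refine lintegral_lintegral_swap (Measurable.aemeasurable ?_)
          unfold Function.uncurry
          fun_prop
      _ ≤ ∫⁻ z in Z, ‖z‖ₑ ^ 2 * ∫⁻ x in Ω, ‖fderiv ℝ w x‖ₑ ^ 2 := by
          refine setLIntegral_mono' Metric.isOpen_ball.measurableSet fun z hz =>
            lintegral_translate_le hΩ hAm hwΩ fun a ha t ht => ?_
          rcases ht.1.eq_or_lt with h0 | h0
          · rw [← h0, zero_smul, add_zero]; exact ha.2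
          · exact h a ⟨subset_closure ha.2, ha.1⟩ z hz t ⟨h0, ht.2⟩
      _ = (∫⁻ z in Z, ‖z‖ₑ ^ 2) * ∫⁻ x in Ω, ‖fderiv ℝ w x‖ₑ ^ 2 :=
          lintegral_mul_const _ (by fun_prop)

/-- The local Poincaré inequality, up to the boundary. -/
theorem IsSmoothBoundedDomain.exists_local_diffBound (hΩ : IsSmoothBoundedDomain Ω)
    (hx : x ∈ closure Ω) :
    ∃ r : ℝ, 0 < r ∧ DiffBound Ω (Metric.ball x r ∩ Ω) (Metric.ball x r ∩ Ω) := by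
  obtain ⟨p, r, hr, h⟩ := hΩ.exists_cone hx
  have h1 := diffBound_of_cone hΩ.isOpen h
  have hfin : volume (Metric.ball x r ∩ Ω) ≠ ⊤ :=
    measure_ne_top_of_subset inter_subset_left measure_ball_lt_top.ne
  exact ⟨r, hr, h1.trans h1 (Metric.measure_ball_pos _ _ hr).ne' measure_ball_lt_top.ne hfin hfin⟩

/-- The local inequalities are chained together through the connected set `Ω`. -/
theorem IsSmoothBoundedDomain.diffBound (hΩ : IsSmoothBoundedDomain Ω) : DiffBound Ω Ω Ω := by
  obtain ⟨x₀, hx₀⟩ := hΩ.isConnected.nonempty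
  obtain ⟨r₀, hr₀, h₀⟩ := hΩ.exists_local_diffBound (subset_closure hx₀)
  set B := Metric.ball x₀ r₀ ∩ Ω with hB
  have hfin : ∀ y r, volume (Metric.ball y r ∩ Ω) ≠ ⊤ := fun y r =>
    measure_ne_top_of_subset inter_subset_left measure_ball_lt_top.ne
  let u : Set (EuclideanSpace ℝ (Fin N)) := {x | ∃ r > 0, DiffBound Ω B (Metric.ball x r ∩ Ω)}
  have hstep : ∀ x ∈ closure Ω, ∀ r, DiffBound Ω (Metric.ball x r ∩ Ω) (Metric.ball x r ∩ Ω) →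
      0 < r → (u ∩ (Metric.ball x r ∩ Ω)).Nonempty → x ∈ u := by
    rintro x hx r h hr ⟨y, ⟨s, hs, hy⟩, hyx, hyΩ⟩
    set G := Metric.ball x r ∩ Ω ∩ Metric.ball y s with hG
    have hGo : IsOpen G := (Metric.isOpen_ball.inter hΩ.isOpen).inter Metric.isOpen_ball
    have hGpos : volume G ≠ 0 :=
      (hGo.measure_pos volume ⟨y, ⟨hyx, hyΩ⟩, Metric.mem_ball_self hs⟩).ne'
    refine ⟨r, hr, (hy.mono_right (D := G) fun z hz => ⟨hz.2, hz.1.2⟩).trans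
      (h.mono_right (D := G) fun z hz => hz.1) hGpos ?_ (hfin _ _) (hfin _ _)⟩
    exact measure_ne_top_of_subset inter_subset_left (hfin x r)
  have hopen : IsOpen u := by
    rw [Metric.isOpen_iff]
    rintro x ⟨r, hr, h⟩
    refine ⟨r / 2, half_pos hr, fun y hy => ⟨r / 2, half_pos hr, h.mono_right ?_⟩⟩
    refine inter_subset_inter_left _ (Metric.ball_subset_ball' ?_)
    rw [Metric.mem_ball] at hy
    linarith
  have hΩu : Ω ⊆ u := by
    refine hΩ.isConnected.isPreconnected.subset_of_closure_inter_subset hopen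
      ⟨x₀, hx₀, r₀, hr₀, h₀⟩ ?_
    rintro x ⟨hxu, hx⟩
    obtain ⟨r, hr, h⟩ := hΩ.exists_local_diffBound (subset_closure hx)
    refine hstep x (subset_closure hx) r h hr ?_
    rw [inter_comm]
    exact mem_closure_iff.1 hxu _ (Metric.isOpen_ball.inter hΩ.isOpen) ⟨Metric.mem_ball_self hr, hx⟩
  have hKu : closure Ω ⊆ u := fun x hx => by
    obtain ⟨r, hr, h⟩ := hΩ.exists_local_diffBound hx
    refine hstep x hx r h hr ?_
    obtain ⟨y, hy, hyΩ⟩ := mem_closure_iff.1 hx _ Metric.isOpen_ball (Metric.mem_ball_self hr)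
    exact ⟨y, hΩu hyΩ, hy, hyΩ⟩
  have hBΩ : DiffBound Ω B (closure Ω ∩ Ω) := by
    refine hΩ.isCompact_closure.induction_on (p := fun s => DiffBound Ω B (s ∩ Ω)) ?_ ?_ ?_ ?_
    · exact h₀.mono_right (by simp)
    · exact fun s t hst ht => ht.mono_right (inter_subset_inter_left _ hst)
    · intro s t hs ht
      rw [union_inter_distrib_right]
      exact hs.union_right ht
    · intro x hx
      obtain ⟨r, hr, h⟩ := hKu hx
      exact ⟨Metric.ball x r, mem_nhdsWithin_of_mem_nhds (Metric.ball_mem_nhds x hr), h⟩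
  rw [inter_eq_right.2 subset_closure] at hBΩ
  have hBpos : volume B ≠ 0 := ((Metric.isOpen_ball.inter hΩ.isOpen).measure_pos volume
    ⟨x₀, Metric.mem_ball_self hr₀, hx₀⟩).ne'
  have hΩfin : volume Ω ≠ ⊤ := hΩ.isBounded.measure_lt_top.ne
  exact hBΩ.symm.trans hBΩ.symm hBpos (hfin _ _) hΩfin hΩfin

theorem IsSmoothBoundedDomain.integrableOn (hΩ : IsSmoothBoundedDomain Ω)
    (hw : ContinuousOn w (closure Ω)) : IntegrableOn w Ω :=
  (hw.integrableOn_compact hΩ.isCompact_closure).mono_set subset_closure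

theorem IsSmoothBoundedDomain.measureReal_pos (hΩ : IsSmoothBoundedDomain Ω) :
    0 < volume.real Ω :=
  ENNReal.toReal_pos (hΩ.isOpen.measure_pos volume hΩ.isConnected.nonempty).ne'
    hΩ.isBounded.measure_lt_top.ne

/-- The Poincaré inequality for functions of class `C¹` on the closure. -/
theorem IsSmoothBoundedDomain.exists_poincare (hΩ : IsSmoothBoundedDomain Ω) :
    ∃ C : ℝ, 0 ≤ C ∧ ∀ (w : EuclideanSpace ℝ (Fin N) → ℝ) (m : ℝ),
      ContDiffOn ℝ 1 w (closure Ω) → ∫ x in Ω, (w x - m) = 0 →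
        ∫ x in Ω, (w x - m) ^ 2 ≤ C * ∫ x in Ω, ‖fderiv ℝ w x‖ ^ 2 := by
  obtain ⟨C, hC, h⟩ := hΩ.diffBound
  have hV := hΩ.measureReal_pos
  have hΩm := hΩ.isOpen.measurableSet
  refine ⟨C.toReal / (2 * volume.real Ω), by positivity, fun w m hw hm => ?_⟩
  have hc := hw.continuousOn
  set q := ∫ x in Ω, (w x - m) ^ 2 with hq
  have hq0 : 0 ≤ q := integral_nonneg fun x => sq_nonneg _
  have hinner : ∀ x, ∫ y in Ω, (w x - w y) ^ 2 = volume.real Ω * (w x - m) ^ 2 + q := fun x => by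
    have e : ∀ y, (w x - w y) ^ 2
        = (w x - m) ^ 2 - 2 * (w x - m) * (w y - m) + (w y - m) ^ 2 := fun y => by ring
    simp only [e]
    rw [integral_add, integral_sub, integral_const_mul, hm, setIntegral_const, smul_eq_mul]
    · ring
    all_goals exact hΩ.integrableOn (by fun_prop)
  have houter : ∫ x in Ω, (volume.real Ω * (w x - m) ^ 2 + q) = 2 * volume.real Ω * q := by
    rw [integral_add, integral_const_mul, setIntegral_const, smul_eq_mul]
    · ring
    all_goals exact hΩ.integrableOn (by fun_prop)
  set v := Ω.indicator w with hv
  have hvw : ∀ x ∈ Ω, v =ᶠ[𝓝 x] w := fun x hx => by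
    filter_upwards [hΩ.isOpen.mem_nhds hx] with y hy using indicator_of_mem hy _
  have hvm : Measurable v := by
    classical
    rw [hv, ← piecewise_eq_indicator]
    exact (hc.mono subset_closure).measurable_piecewise continuousOn_const hΩm
  have hvd : ContDiffOn ℝ 1 v Ω :=
    (hw.mono subset_closure).congr fun x hx => indicator_of_mem hx _
  have hmain := h v hvm hvd
  have hL : ∫⁻ x in Ω, ∫⁻ y in Ω, ‖v x - v y‖ₑ ^ 2
      = ENNReal.ofReal (2 * volume.real Ω * q) := by
    rw [← houter, ofReal_integral_eq_lintegral_ofReal (hΩ.integrableOn (by fun_prop))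
      (Eventually.of_forall fun x => by positivity)]
    refine setLIntegral_congr_fun hΩm fun x hx => ?_
    rw [← hinner x, ofReal_integral_eq_lintegral_ofReal (hΩ.integrableOn (by fun_prop))
      (Eventually.of_forall fun y => sq_nonneg _)]
    refine setLIntegral_congr_fun hΩm fun y hy => ?_
    simp only [(hvw x hx).eq_of_nhds, (hvw y hy).eq_of_nhds, enorm_sq_eq_ofReal]
  have hR : ∫⁻ x in Ω, ‖fderiv ℝ v x‖ₑ ^ 2
      = ENNReal.ofReal (∫ x in Ω, ‖fderiv ℝ w x‖ ^ 2) := by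
    rw [ofReal_integral_eq_lintegral_ofReal _ (Eventually.of_forall fun x => sq_nonneg _)]
    · refine setLIntegral_congr_fun hΩm fun x hx => ?_
      simp only [(hvw x hx).fderiv_eq]
      rw [← ofReal_norm, ENNReal.ofReal_pow (norm_nonneg _)]
    · have h1 : ContinuousOn (fun x => ‖fderivWithin ℝ w (closure Ω) x‖ ^ 2) (closure Ω) :=
        ((hw.continuousOn_fderivWithin hΩ.uniqueDiffOn_closure le_rfl).norm).pow 2
      refine (hΩ.integrableOn h1).congr_fun (fun x hx => ?_) hΩm
      simp only [fderivWithin_closure_eq hΩ.isOpen hx]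
  have hI0 : 0 ≤ ∫ x in Ω, ‖fderiv ℝ w x‖ ^ 2 := integral_nonneg fun x => sq_nonneg _
  rw [hL, hR, ← ENNReal.ofReal_toReal hC, ← ENNReal.ofReal_mul ENNReal.toReal_nonneg,
    ENNReal.ofReal_le_ofReal_iff (by positivity)] at hmain
  rw [div_mul_eq_mul_div, le_div_iff₀ (by positivity)]
  linarith

end Poincare

/-! ### The maximum principle -/

section MaximumPrinciple

variable {N : ℕ} {Ω : Set (EuclideanSpace ℝ (Fin N))} {x : EuclideanSpace ℝ (Fin N)}
  {w : EuclideanSpace ℝ (Fin N) → ℝ}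

/-- At a critical maximum point the second derivative is nonpositive along every direction that
points into `Ω`. -/
theorem IsSmoothBoundedDomain.fderivWithin_two_nonpos (hΩ : IsSmoothBoundedDomain Ω)
    (hw : ContDiffOn ℝ 2 w (closure Ω)) (hx : x ∈ closure Ω) (hmax : IsMaxOn w (closure Ω) x)
    (h0 : fderivWithin ℝ w (closure Ω) x = 0) {v : EuclideanSpace ℝ (Fin N)}
    (hv : ∀ᶠ t : ℝ in 𝓝[>] 0, x + t • v ∈ Ω) :
    fderivWithin ℝ (fderivWithin ℝ w (closure Ω)) (closure Ω) x v v ≤ 0 := by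
  set K := closure Ω with hK
  set c := fderivWithin ℝ (fderivWithin ℝ w K) K x v v with hc
  by_contra! hpos
  obtain ⟨ε, hε, hin⟩ := (mem_nhdsGT_iff_exists_Ioo_subset).1 hv
  have hε0 : (0 : ℝ) < ε := hε
  have hmaps : MapsTo (fun t : ℝ => x + t • v) (Ico 0 ε) K := fun t ht => by
    rcases ht.1.eq_or_lt with h | h
    · simpa [← h] using hx
    · exact subset_closure (hin ⟨h, ht.2⟩)
  have hline : ∀ t : ℝ, HasDerivAt (fun t : ℝ => x + t • v) v t := fun t => by
    simpa using ((hasDerivAt_id t).smul_const v).const_add x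
  have hg : HasDerivWithinAt (fun t : ℝ => fderivWithin ℝ w K (x + t • v) v) c (Ico 0 ε) 0 := by
    have h1 : HasFDerivWithinAt (fderivWithin ℝ w K)
        (fderivWithin ℝ (fderivWithin ℝ w K) K x) K (x + (0 : ℝ) • v) := by
      rw [zero_smul, add_zero]
      exact ((hΩ.contDiffOn_fderivWithin hw).differentiableOn one_ne_zero x hx).hasFDerivWithinAt
    have h2 := h1.comp_hasDerivWithinAt (0 : ℝ) (hline 0).hasDerivWithinAt hmaps
    simpa using h2.clm_apply (hasDerivWithinAt_const (0 : ℝ) (Ico 0 ε) v)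
  have hslope := hasDerivWithinAt_iff_tendsto_slope.1 hg
  have hset : Ico 0 ε \ {0} = Ioo 0 ε := Ico_sdiff_left
  rw [hset] at hslope
  rw [nhdsWithin_Ioo_eq_nhdsGT hε0] at hslope
  obtain ⟨η, hη, hηpos⟩ := (mem_nhdsGT_iff_exists_Ioo_subset).1
    (hslope.eventually (lt_mem_nhds hpos))
  have hη0 : (0 : ℝ) < η := hη
  set s := min ε η / 2 with hs
  have hs0 : 0 < s := half_pos (lt_min hε0 hη0)
  have hsε : s < ε := (half_lt_self (lt_min hε0 hη0)).trans_le (min_le_left _ _)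
  have hsη : s < η := (half_lt_self (lt_min hε0 hη0)).trans_le (min_le_right _ _)
  have hmono : StrictMonoOn (fun t : ℝ => w (x + t • v)) (Icc 0 s) := by
    refine strictMonoOn_of_deriv_pos (convex_Icc 0 s) ?_ fun t ht => ?_
    · exact hw.continuousOn.comp (by fun_prop) fun t ht => hmaps ⟨ht.1, ht.2.trans_lt hsε⟩
    · rw [interior_Icc] at ht
      have htΩ : x + t • v ∈ Ω := hin ⟨ht.1, ht.2.trans hsε⟩
      have h1 : HasDerivAt (fun t : ℝ => w (x + t • v)) (fderiv ℝ w (x + t • v) v) t :=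
        ((contDiffAt_of_closure hΩ.isOpen htΩ hw).differentiableAt
          two_ne_zero).hasFDerivAt.comp_hasDerivAt t (hline t)
      rw [h1.deriv, ← fderivWithin_closure_eq hΩ.isOpen htΩ]
      have h2 : 0 < slope (fun t : ℝ => fderivWithin ℝ w K (x + t • v) v) 0 t :=
        hηpos ⟨ht.1, ht.2.trans hsη⟩
      rw [slope_def_field] at h2
      simp only [zero_smul, add_zero, h0, zero_apply, sub_zero] at h2
      exact (div_pos_iff_of_pos_right ht.1).1 h2
  have h1 := hmono (left_mem_Icc.2 hs0.le) (right_mem_Icc.2 hs0.le) hs0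
  simp only [zero_smul, add_zero] at h1
  exact absurd (hmax (hmaps ⟨hs0.le, hsε⟩)) (not_le.2 h1)

theorem fderivWithin_nonpos_of_isMaxOn (hx : x ∈ closure Ω)
    (hw : ContDiffOn ℝ 2 w (closure Ω)) (hmax : IsMaxOn w (closure Ω) x)
    {v : EuclideanSpace ℝ (Fin N)} (hv : ∀ᶠ t : ℝ in 𝓝[>] 0, x + t • v ∈ Ω) :
    fderivWithin ℝ w (closure Ω) x v ≤ 0 :=
  hmax.localize.hasFDerivWithinAt_nonpos
    (hw.differentiableOn two_ne_zero x hx).hasFDerivWithinAt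
    (mem_posTangentConeAt_of_frequently_mem (hv.mono fun _ h => subset_closure h).frequently)

/-- The weak maximum principle up to the boundary. At a boundary maximum the Neumann condition
makes the full gradient vanish; the second derivative is then nonpositive along inward directions,
hence, being even and continuous, along all directions. -/
theorem IsSmoothBoundedDomain.closureLaplacian_nonpos (hΩ : IsSmoothBoundedDomain Ω)
    (hw : ContDiffOn ℝ 2 w (closure Ω)) (hN : NeumannCondition Ω w) (hx : x ∈ closure Ω)
    (hmax : IsMaxOn w (closure Ω) x) : closureLaplacian Ω w x ≤ 0 := by
  set K := closure Ω with hK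
  suffices h : ∀ v, fderivWithin ℝ (fderivWithin ℝ w K) K x v v ≤ 0 from
    Finset.sum_nonpos fun i _ => h _
  have hzero : (∀ v, fderivWithin ℝ w K x v ≤ 0) → fderivWithin ℝ w K x = 0 := fun h => by
    ext v
    refine le_antisymm (h v) ?_
    have := h (-v)
    rw [map_neg] at this
    simpa using this
  by_cases hxΩ : x ∈ Ω
  · have hin : ∀ v : EuclideanSpace ℝ (Fin N), ∀ᶠ t : ℝ in 𝓝[>] 0, x + t • v ∈ Ω := fun v => by
      have hc : ContinuousAt (fun t : ℝ => x + t • v) 0 := by fun_prop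
      refine (hc.tendsto.mono_left nhdsWithin_le_nhds).eventually ?_
      rw [zero_smul, add_zero]
      exact hΩ.isOpen.mem_nhds hxΩ
    have h0 := hzero fun v => fderivWithin_nonpos_of_isMaxOn hx hw hmax (hin v)
    exact fun v => hΩ.fderivWithin_two_nonpos hw hx hmax h0 (hin v)
  · have hxf : x ∈ frontier Ω := by rw [hΩ.isOpen.frontier_eq]; exact ⟨hx, hxΩ⟩
    obtain ⟨e, ρ, r, hc⟩ := hΩ.exists_chart hxf
    have hin := fun v (hv : fderiv ℝ ρ x v < 0) => hc.eventually_mem hΩ.isOpen hxf hv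
    set n := gradient ρ x with hn
    have hwn : fderivWithin ℝ w K x n = 0 :=
      hc.fderivWithin_gradient hN hxf (Metric.mem_ball_self hc.pos)
    have hρ : ∀ v, fderiv ℝ ρ x v = inner ℝ n v := fun v => by simp [hn, gradient]
    have hρe := hc.fderiv_apply_self x
    have hnn : 0 < fderiv ℝ ρ x n := by
      rw [hρ, real_inner_self_eq_norm_sq]
      have hne : n ≠ 0 := fun h => by
        rw [hρ, h, inner_zero_left] at hρe
        exact zero_ne_one hρe
      positivity
    have h0 : fderivWithin ℝ w K x = 0 := hzero fun v => by
      -- subtracting a multiple of `n` turns `v` inward and does not change the derivative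
      have hv : fderiv ℝ ρ x (v - ((fderiv ℝ ρ x v + 1) / fderiv ℝ ρ x n) • n) < 0 := by
        rw [map_sub, map_smul, smul_eq_mul, div_mul_cancel₀ _ hnn.ne']
        linarith
      have := fderivWithin_nonpos_of_isMaxOn hx hw hmax (hin _ hv)
      rwa [map_sub, map_smul, hwn, smul_zero, sub_zero] at this
    set q := fderivWithin ℝ (fderivWithin ℝ w K) K x with hq
    have hle : ∀ v, fderiv ℝ ρ x v ≤ 0 → q v v ≤ 0 := fun v hv => by
      have hcont : Continuous fun s : ℝ => q (v - s • e) (v - s • e) := by fun_prop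
      have hlim : Tendsto (fun s : ℝ => q (v - s • e) (v - s • e)) (𝓝[>] 0) (𝓝 (q v v)) := by
        have := (hcont.tendsto 0).mono_left (nhdsWithin_le_nhds (s := Ioi (0 : ℝ)))
        simpa only [zero_smul, sub_zero] using this
      refine le_of_tendsto hlim ?_
      filter_upwards [self_mem_nhdsWithin] with s hs
      refine hΩ.fderivWithin_two_nonpos hw hx hmax h0 (hin _ ?_)
      rw [map_sub, map_smul, hρe, smul_eq_mul, mul_one]
      have hs0 : (0 : ℝ) < s := hs
      linarith
    intro v
    rcases le_total (fderiv ℝ ρ x v) 0 with h | h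
    · exact hle v h
    · have := hle (-v) (by rw [map_neg]; linarith)
      simpa using this

theorem IsSmoothBoundedDomain.neumannCondition_neg (hΩ : IsSmoothBoundedDomain Ω)
    (h : NeumannCondition Ω w) : NeumannCondition Ω fun y => -w y := fun y hy ν hν => by
  rw [fderivWithin_fun_neg (hΩ.uniqueDiffOn_closure y (frontier_subset_closure hy)), neg_apply,
    h y hy ν hν, neg_zero]

theorem IsSmoothBoundedDomain.closureLaplacian_neg (hΩ : IsSmoothBoundedDomain Ω)
    (w : EuclideanSpace ℝ (Fin N) → ℝ) (hx : x ∈ closure Ω) :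
    closureLaplacian Ω (fun y => -w y) x = -closureLaplacian Ω w x := by
  have hu := hΩ.uniqueDiffOn_closure
  have h : ∀ y ∈ closure Ω, fderivWithin ℝ (fun y => -w y) (closure Ω) y
      = -fderivWithin ℝ w (closure Ω) y := fun y hy => fderivWithin_fun_neg (hu y hy)
  unfold closureLaplacian
  rw [fderivWithin_congr h (h x hx), fderivWithin_fun_neg (hu x hx)]
  simp

end MaximumPrinciple

/-! ### The reaction terms -/

section Reaction

variable {a₁ a₂ b₁ b₂ c₁ c₂ γ δ τ T u v : ℝ}

theorem vOf_pos (hγ : 0 < γ) (hδ : 0 < δ) (hτ : 0 < τ) (s : ℝ) : 0 < vOf γ δ s τ := by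
  rw [vOf_eq hγ hδ hτ]
  exact div_pos hτ (uOf_pos hγ hδ hτ)

theorem uOf_mul_vOf (hγ : 0 < γ) (hδ : 0 < δ) (hτ : 0 < τ) (s : ℝ) :
    uOf γ δ s τ * vOf γ δ s τ = τ := by
  rw [vOf_eq hγ hδ hτ]
  exact mul_div_cancel₀ _ (uOf_pos hγ hδ hτ).ne'

theorem uOf_sub_vOf (hγ : 0 < γ) (hδ : 0 < δ) (s : ℝ) :
    δ * uOf γ δ s τ - γ * vOf γ δ s τ = s := by
  unfold uOf vOf
  field_simp
  ring

theorem continuous_uOf (γ δ τ : ℝ) : Continuous fun s => uOf γ δ s τ := by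
  unfold uOf
  fun_prop

theorem continuous_vOf (γ δ τ : ℝ) : Continuous fun s => vOf γ δ s τ := by
  unfold vOf
  fun_prop

/-- The reaction term `f - γ g` of the equation for `w`, as a function of the value `s` of `w`. -/
noncomputable def reactH (a₁ a₂ b₁ b₂ c₁ c₂ γ δ τ s : ℝ) : ℝ :=
  reactF a₁ b₁ c₁ (uOf γ δ s τ) (vOf γ δ s τ) - γ * reactG a₂ b₂ c₂ (uOf γ δ s τ) (vOf γ δ s τ)

theorem continuous_reactF (a₁ b₁ c₁ γ δ τ : ℝ) :
    Continuous fun s => reactF a₁ b₁ c₁ (uOf γ δ s τ) (vOf γ δ s τ) := by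
  have := continuous_uOf γ δ τ
  have := continuous_vOf γ δ τ
  unfold reactF
  fun_prop

theorem continuous_reactG (a₂ b₂ c₂ γ δ τ : ℝ) :
    Continuous fun s => reactG a₂ b₂ c₂ (uOf γ δ s τ) (vOf γ δ s τ) := by
  have := continuous_uOf γ δ τ
  have := continuous_vOf γ δ τ
  unfold reactG
  fun_prop

theorem continuous_reactH (a₁ a₂ b₁ b₂ c₁ c₂ γ δ τ : ℝ) :
    Continuous (reactH a₁ a₂ b₁ b₂ c₁ c₂ γ δ τ) :=
  (continuous_reactF a₁ b₁ c₁ γ δ τ).sub (continuous_const.mul (continuous_reactG a₂ b₂ c₂ γ δ τ))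

theorem reactF_le (hb₁ : 0 < b₁) (huv : u * v = τ) :
    reactF a₁ b₁ c₁ u v ≤ a₁ ^ 2 / (4 * b₁) - c₁ * τ := by
  have h : reactF a₁ b₁ c₁ u v = a₁ * u - b₁ * u ^ 2 - c₁ * τ := by
    rw [← huv, reactF]; ring
  have h2 : a₁ * u - b₁ * u ^ 2 ≤ a₁ ^ 2 / (4 * b₁) := by
    rw [le_div_iff₀ (by positivity)]
    nlinarith [sq_nonneg (a₁ - 2 * b₁ * u)]
  linarith

theorem reactG_le (hc₂ : 0 < c₂) (huv : u * v = τ) :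
    reactG a₂ b₂ c₂ u v ≤ a₂ ^ 2 / (4 * c₂) - b₂ * τ := by
  have h := reactF_le (a₁ := a₂) (c₁ := b₂) hc₂ (mul_comm v u ▸ huv)
  have h2 : reactG a₂ b₂ c₂ u v = reactF a₂ c₂ b₂ v u := by
    rw [reactF, reactG]; ring
  rwa [h2]

theorem le_of_quadratic {a b M u : ℝ} (ha : 0 < a) (hb : 0 < b) (hM : 0 ≤ M)
    (h : b * u ^ 2 ≤ a * u + M) : u ≤ a / b + M / a := by
  by_contra! hlt
  have h1 : a / b + M / a = (a ^ 2 + b * M) / (a * b) := by field_simp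
  rw [h1, div_lt_iff₀ (by positivity)] at hlt
  have h2 : a < b * u := by nlinarith [mul_nonneg hb.le hM]
  have h3 : b * M < a * (b * u - a) := by linarith
  have h4 : a * (b * u - a) < b * u * (b * u - a) := mul_lt_mul_of_pos_right h2 (by linarith)
  nlinarith

/-- Where `f ≥ γ g`, the value of `w` is bounded above. -/
theorem le_of_reaction_nonneg {s : ℝ} (ha₁ : 0 < a₁) (ha₂ : 0 < a₂) (hb₁ : 0 < b₁) (hb₂ : 0 < b₂)
    (hc₁ : 0 < c₁) (hc₂ : 0 < c₂) (hγ : 0 < γ) (hδ : 0 < δ) (hu : 0 < u) (hv : 0 < v)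
    (hs : δ * u - γ * v = s) (hT : u * v ≤ T)
    (h : 0 ≤ reactF a₁ b₁ c₁ u v - γ * reactG a₂ b₂ c₂ u v) :
    s ≤ δ * (a₁ / b₁ + (γ * b₂ * T + c₂ * δ * T) / a₁) := by
  have huv : 0 < u * v := mul_pos hu hv
  have hT0 : 0 < T := huv.trans_le hT
  rcases le_or_gt s 0 with hs0 | hs0
  · exact hs0.trans (by positivity)
  have h1 : γ * v ^ 2 ≤ δ * T := by nlinarith
  have h2 : b₁ * u ^ 2 ≤ a₁ * u + (γ * b₂ * T + c₂ * δ * T) := by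
    unfold reactF reactG at h
    have h3 : γ * b₂ * (u * v) ≤ γ * b₂ * T := mul_le_mul_of_nonneg_left hT (by positivity)
    have h4 : c₂ * (γ * v ^ 2) ≤ c₂ * (δ * T) := mul_le_mul_of_nonneg_left h1 hc₂.le
    have h5 : 0 < c₁ * (u * v) := by positivity
    have h6 : 0 < γ * a₂ * v := by positivity
    nlinarith
  have h3 := le_of_quadratic ha₁ hb₁ (by positivity) h2
  have h4 : s ≤ δ * u := by nlinarith [mul_pos hγ hv]
  exact h4.trans (mul_le_mul_of_nonneg_left h3 hδ.le)

/-- Where `f ≤ γ g`, the value of `w` is bounded below: exchange the roles of `u` and `v`. -/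
theorem neg_le_of_reaction_nonpos {s : ℝ} (ha₁ : 0 < a₁) (ha₂ : 0 < a₂) (hb₁ : 0 < b₁)
    (hb₂ : 0 < b₂) (hc₁ : 0 < c₁) (hc₂ : 0 < c₂) (hγ : 0 < γ) (hδ : 0 < δ) (hu : 0 < u)
    (hv : 0 < v) (hs : δ * u - γ * v = s) (hT : u * v ≤ T)
    (h : reactF a₁ b₁ c₁ u v - γ * reactG a₂ b₂ c₂ u v ≤ 0) :
    -s ≤ γ * (a₂ / c₂ + (γ⁻¹ * c₁ * T + b₁ * δ⁻¹ * T) / a₂) := by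
  have h1 := le_of_reaction_nonneg (a₁ := a₂) (b₁ := c₂) (c₁ := b₂) (a₂ := a₁) (b₂ := c₁)
    (c₂ := b₁) (γ := γ⁻¹) (δ := δ⁻¹) (u := v) (v := u) (s := δ⁻¹ * v - γ⁻¹ * u) (T := T)
    ha₂ ha₁ hc₂ hc₁ hb₂ hb₁ (inv_pos.2 hγ) (inv_pos.2 hδ) hv hu rfl (by rwa [mul_comm]) (by
      have e : reactF a₂ c₂ b₂ v u - γ⁻¹ * reactG a₁ c₁ b₁ v u
          = γ⁻¹ * -(reactF a₁ b₁ c₁ u v - γ * reactG a₂ b₂ c₂ u v) := by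
        unfold reactF reactG
        field_simp
        ring
      rw [e]
      exact mul_nonneg (inv_pos.2 hγ).le (neg_nonneg.2 h))
  have h2 : -s = γ * δ * (δ⁻¹ * v - γ⁻¹ * u) := by
    rw [← hs]
    field_simp
    ring
  rw [h2]
  refine (mul_le_mul_of_nonneg_left h1 (mul_pos hγ hδ).le).trans_eq ?_
  rw [← mul_assoc, mul_assoc γ, mul_inv_cancel₀ hδ.ne', mul_one]

/-- One-sided Lipschitz estimate for `f - γ g`, with a constant not depending on `τ`: `u` and `v`
are Lipschitz monotone functions of `w`, and the quadratic terms have a favourable sign. -/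
theorem reactH_sub_mul_le (ha₁ : 0 < a₁) (ha₂ : 0 < a₂) (hb₁ : 0 < b₁) (hc₂ : 0 < c₂)
    (hγ : 0 < γ) (hδ : 0 < δ) (hτ : 0 < τ) (s t : ℝ) :
    (reactH a₁ a₂ b₁ b₂ c₁ c₂ γ δ τ s - reactH a₁ a₂ b₁ b₂ c₁ c₂ γ δ τ t) * (s - t)
      ≤ (a₁ / δ + a₂) * (s - t) ^ 2 := by
  have hu := uOf_pos (w := s) hγ hδ hτ
  have hu' := uOf_pos (w := t) hγ hδ hτ
  have hv := vOf_pos hγ hδ hτ s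
  have hv' := vOf_pos hγ hδ hτ t
  have huv := uOf_mul_vOf hγ hδ hτ s
  have huv' := uOf_mul_vOf hγ hδ hτ t
  have hs := uOf_sub_vOf (τ := τ) hγ hδ s
  have ht := uOf_sub_vOf (τ := τ) hγ hδ t
  unfold reactH reactF reactG
  generalize uOf γ δ s τ = u at *
  generalize vOf γ δ s τ = v at *
  generalize uOf γ δ t τ = u' at *
  generalize vOf γ δ t τ = v' at *
  have hcross : (u - u') * (v - v') ≤ 0 := by
    have h1 : (u * u') * ((u - u') * (v - v')) = -(τ * (u - u') ^ 2) := by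
      linear_combination (u' * (u - u')) * huv - u * (u - u') * huv'
    have h2 : 0 < u * u' := mul_pos hu hu'
    by_contra! h3
    have := mul_pos h2 h3
    nlinarith [mul_nonneg hτ.le (sq_nonneg (u - u'))]
  have hst : s - t = δ * (u - u') - γ * (v - v') := by rw [← hs, ← ht]; ring
  set p := (u - u') * (s - t) with hp
  set q := -((v - v') * (s - t)) with hq
  have hp0 : 0 ≤ p := by
    have : p = δ * (u - u') ^ 2 - γ * ((u - u') * (v - v')) := by rw [hp, hst]; ring
    rw [this]
    nlinarith [mul_nonneg hδ.le (sq_nonneg (u - u')), mul_nonneg hγ.le (neg_nonneg.2 hcross)]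
  have hq0 : 0 ≤ q := by
    have : q = γ * (v - v') ^ 2 - δ * ((u - u') * (v - v')) := by rw [hq, hst]; ring
    rw [this]
    nlinarith [mul_nonneg hγ.le (sq_nonneg (v - v')), mul_nonneg hδ.le (neg_nonneg.2 hcross)]
  have hpq : (s - t) ^ 2 = δ * p + γ * q := by
    rw [hp, hq]
    linear_combination (s - t) * hst
  have hexp : (u * (a₁ - b₁ * u - c₁ * v) - γ * (v * (a₂ - b₂ * u - c₂ * v))
      - (u' * (a₁ - b₁ * u' - c₁ * v') - γ * (v' * (a₂ - b₂ * u' - c₂ * v')))) * (s - t)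
      = a₁ * p + γ * a₂ * q - b₁ * (p * (u + u')) - γ * c₂ * (q * (v + v')) := by
    rw [hp, hq]
    linear_combination (γ * b₂ - c₁) * (s - t) * (huv - huv')
  have e1 : a₁ / δ * (δ * p + γ * q) = a₁ * p + a₁ / δ * (γ * q) := by field_simp
  rw [hexp, hpq, add_mul, e1]
  have k1 : 0 ≤ b₁ * (p * (u + u')) := by positivity
  have k2 : 0 ≤ γ * c₂ * (q * (v + v')) := by positivity
  have k3 : 0 ≤ a₁ / δ * (γ * q) := by positivity
  have k4 : 0 ≤ a₂ * (δ * p) := by positivity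
  linarith

end Reaction

/-! ### Solutions of the limiting system -/

section Solutions

variable {a₁ a₂ b₁ b₂ c₁ c₂ γ δ d τ : ℝ} {N : ℕ} {Ω : Set (EuclideanSpace ℝ (Fin N))}
  {x : EuclideanSpace ℝ (Fin N)} {w : EuclideanSpace ℝ (Fin N) → ℝ}

namespace IsSolution

theorem laplacian_eq (h : IsSolution a₁ a₂ b₁ b₂ c₁ c₂ γ δ Ω d w τ) (hx : x ∈ Ω) :
    d * Laplacian.laplacian w x = -reactH a₁ a₂ b₁ b₂ c₁ c₂ γ δ τ (w x) := by
  rw [reactH]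
  linarith [h.equation x hx]

/-- The equation extends to the closure by continuity. -/
theorem closureLaplacian_eq (h : IsSolution a₁ a₂ b₁ b₂ c₁ c₂ γ δ Ω d w τ)
    (hΩ : IsSmoothBoundedDomain Ω) (hx : x ∈ closure Ω) :
    d * closureLaplacian Ω w x = -reactH a₁ a₂ b₁ b₂ c₁ c₂ γ δ τ (w x) := by
  have heq : EqOn (fun y => d * closureLaplacian Ω w y)
      (fun y => -reactH a₁ a₂ b₁ b₂ c₁ c₂ γ δ τ (w y)) Ω := fun y hy => by
    simp only [FullCross.closureLaplacian_eq hΩ.isOpen hy, h.laplacian_eq hy]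
  exact heq.of_subset_closure
    (continuousOn_const.mul (hΩ.continuousOn_closureLaplacian h.contDiffOn))
    ((continuous_reactH a₁ a₂ b₁ b₂ c₁ c₂ γ δ τ).comp_continuousOn h.contDiffOn.continuousOn).neg
    subset_closure subset_rfl hx

theorem integral_laplacian (h : IsSolution a₁ a₂ b₁ b₂ c₁ c₂ γ δ Ω d w τ)
    (hΩ : IsSmoothBoundedDomain Ω) : ∫ y in Ω, Laplacian.laplacian w y = 0 := by
  have := hΩ.integral_divGrad h.contDiffOn h.neumann (ψ := fun _ => 1) contDiffOn_const
  simpa [divGrad, gradient] using this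

theorem integral_reactH (h : IsSolution a₁ a₂ b₁ b₂ c₁ c₂ γ δ Ω d w τ)
    (hΩ : IsSmoothBoundedDomain Ω) :
    ∫ y in Ω, reactH a₁ a₂ b₁ b₂ c₁ c₂ γ δ τ (w y) = 0 := by
  have e : ∀ y ∈ Ω, reactH a₁ a₂ b₁ b₂ c₁ c₂ γ δ τ (w y) = -d * Laplacian.laplacian w y :=
    fun y hy => by rw [neg_mul, h.laplacian_eq hy, neg_neg]
  rw [setIntegral_congr_fun hΩ.isOpen.measurableSet e, integral_const_mul,
    h.integral_laplacian hΩ, mul_zero]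

theorem integral_reactG (h : IsSolution a₁ a₂ b₁ b₂ c₁ c₂ γ δ Ω d w τ)
    (hΩ : IsSmoothBoundedDomain Ω) (hγ : 0 < γ) :
    ∫ y in Ω, reactG a₂ b₂ c₂ (uOf γ δ (w y) τ) (vOf γ δ (w y) τ) = 0 := by
  have h1 := h.integral_reactH hΩ
  have hc := h.contDiffOn.continuousOn
  have hF : IntegrableOn (fun y => reactF a₁ b₁ c₁ (uOf γ δ (w y) τ) (vOf γ δ (w y) τ)) Ω :=
    hΩ.integrableOn ((continuous_reactF a₁ b₁ c₁ γ δ τ).comp_continuousOn hc)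
  have hG : IntegrableOn (fun y => reactG a₂ b₂ c₂ (uOf γ δ (w y) τ) (vOf γ δ (w y) τ)) Ω :=
    hΩ.integrableOn ((continuous_reactG a₂ b₂ c₂ γ δ τ).comp_continuousOn hc)
  simp only [reactH] at h1
  rw [integral_sub hF (hG.const_mul γ), h.constraint, integral_const_mul, zero_sub,
    neg_eq_zero, mul_eq_zero] at h1
  exact h1.resolve_left hγ.ne'

theorem tau_le (h : IsSolution a₁ a₂ b₁ b₂ c₁ c₂ γ δ Ω d w τ) (hΩ : IsSmoothBoundedDomain Ω)
    (hb₁ : 0 < b₁) (hb₂ : 0 < b₂) (hc₁ : 0 < c₁) (hc₂ : 0 < c₂) (hγ : 0 < γ) (hδ : 0 < δ) :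
    τ ≤ min (a₁ ^ 2 / (4 * b₁ * c₁)) (a₂ ^ 2 / (4 * b₂ * c₂)) := by
  have hV := hΩ.measureReal_pos
  have hc := h.contDiffOn.continuousOn
  have key : ∀ (F : ℝ → ℝ) (B : ℝ), Continuous F → (∀ s, F s ≤ B) → ∫ y in Ω, F (w y) = 0 →
      0 ≤ B := fun F B hF hB h0 => by
    have h1 : ∫ y in Ω, F (w y) ≤ ∫ _y in Ω, B :=
      integral_mono (hΩ.integrableOn (hF.comp_continuousOn hc))
        (hΩ.integrableOn continuousOn_const) fun y => hB (w y)
    rw [h0, setIntegral_const, smul_eq_mul] at h1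
    exact nonneg_of_mul_nonneg_right h1 hV
  have h1 := key _ _ (continuous_reactF a₁ b₁ c₁ γ δ τ)
    (fun s => reactF_le hb₁ (uOf_mul_vOf hγ hδ h.tau_pos s)) h.constraint
  have h2 := key _ _ (continuous_reactG a₂ b₂ c₂ γ δ τ)
    (fun s => reactG_le hc₂ (uOf_mul_vOf hγ hδ h.tau_pos s)) (h.integral_reactG hΩ hγ)
  rw [sub_nonneg, le_div_iff₀ (by positivity)] at h1 h2
  refine le_min ?_ ?_ <;> rw [le_div_iff₀ (by positivity)] <;> linarith

/-- The a priori bound for `w`: evaluate the equation at a maximum and at a minimum point. -/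
theorem abs_le (h : IsSolution a₁ a₂ b₁ b₂ c₁ c₂ γ δ Ω d w τ) (hΩ : IsSmoothBoundedDomain Ω)
    (ha₁ : 0 < a₁) (ha₂ : 0 < a₂) (hb₁ : 0 < b₁) (hb₂ : 0 < b₂) (hc₁ : 0 < c₁) (hc₂ : 0 < c₂)
    (hγ : 0 < γ) (hδ : 0 < δ) (hd : 0 < d) {T : ℝ} (hT : τ ≤ T) (hx : x ∈ closure Ω) :
    |w x| ≤ max (δ * (a₁ / b₁ + (γ * b₂ * T + c₂ * δ * T) / a₁))
      (γ * (a₂ / c₂ + (γ⁻¹ * c₁ * T + b₁ * δ⁻¹ * T) / a₂)) := by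
  have hc := h.contDiffOn.continuousOn
  have hne : (closure Ω).Nonempty := ⟨x, hx⟩
  obtain ⟨p, hp, hmax⟩ := hΩ.isCompact_closure.exists_isMaxOn hne hc
  obtain ⟨q, hq, hmin⟩ := hΩ.isCompact_closure.exists_isMinOn hne hc
  have hLp := hΩ.closureLaplacian_nonpos h.contDiffOn h.neumann hp hmax
  have hLq := hΩ.closureLaplacian_nonpos h.contDiffOn.neg (hΩ.neumannCondition_neg h.neumann) hq
    hmin.neg
  rw [hΩ.closureLaplacian_neg w hq, neg_nonpos] at hLq
  have hHp : 0 ≤ reactH a₁ a₂ b₁ b₂ c₁ c₂ γ δ τ (w p) := by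
    have := h.closureLaplacian_eq hΩ hp
    nlinarith
  have hHq : reactH a₁ a₂ b₁ b₂ c₁ c₂ γ δ τ (w q) ≤ 0 := by
    have := h.closureLaplacian_eq hΩ hq
    nlinarith
  have hτ := h.tau_pos
  have h1 := le_of_reaction_nonneg ha₁ ha₂ hb₁ hb₂ hc₁ hc₂ hγ hδ (uOf_pos hγ hδ hτ)
    (vOf_pos hγ hδ hτ _) (uOf_sub_vOf hγ hδ _) ((uOf_mul_vOf hγ hδ hτ _).trans_le hT) hHp
  have h2 := neg_le_of_reaction_nonpos ha₁ ha₂ hb₁ hb₂ hc₁ hc₂ hγ hδ (uOf_pos hγ hδ hτ)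
    (vOf_pos hγ hδ hτ _) (uOf_sub_vOf hγ hδ _) ((uOf_mul_vOf hγ hδ hτ _).trans_le hT) hHq
  exact abs_le'.2 ⟨((hmax hx).trans h1).trans (le_max_left _ _),
    ((neg_le_neg (hmin hx)).trans h2).trans (le_max_right _ _)⟩

/-- The energy identity, obtained by testing the equation with `w - m`. -/
theorem energy_eq (h : IsSolution a₁ a₂ b₁ b₂ c₁ c₂ γ δ Ω d w τ) (hΩ : IsSmoothBoundedDomain Ω)
    (m : ℝ) : d * ∫ y in Ω, ‖fderiv ℝ w y‖ ^ 2
      = ∫ y in Ω, reactH a₁ a₂ b₁ b₂ c₁ c₂ γ δ τ (w y) * (w y - m) := by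
  have hψ : ContDiffOn ℝ 1 (fun y => w y - m) (closure Ω) :=
    (h.contDiffOn.of_le one_le_two).sub contDiffOn_const
  have h0 := hΩ.integral_divGrad h.contDiffOn h.neumann hψ
  have hgrad : ∀ y, fderiv ℝ w y (gradient (fun y => w y - m) y) = ‖fderiv ℝ w y‖ ^ 2 :=
    fun y => by
      have e : fderiv ℝ w y = InnerProductSpace.toDual ℝ _ (gradient w y) := by simp [gradient]
      have e2 : gradient (fun y => w y - m) y = gradient w y := by
        simp only [gradient, fderiv_sub_const]
      rw [e2, e, InnerProductSpace.toDual_apply_apply, real_inner_self_eq_norm_sq,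
        LinearIsometryEquiv.norm_map]
  have e : ∀ y ∈ Ω, d * ‖fderiv ℝ w y‖ ^ 2 = d * divGrad (fun y => w y - m) w y
      + reactH a₁ a₂ b₁ b₂ c₁ c₂ γ δ τ (w y) * (w y - m) := fun y hy => by
    rw [divGrad, hgrad]
    linear_combination (m - w y) * h.laplacian_eq hy
  rw [← integral_const_mul, setIntegral_congr_fun hΩ.isOpen.measurableSet e, integral_add,
    integral_const_mul, h0, mul_zero, zero_add]
  · exact (hΩ.integrableOn_divGrad h.contDiffOn hψ).const_mul d
  · refine hΩ.integrableOn (ContinuousOn.mul ?_ hψ.continuousOn)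
    exact (continuous_reactH a₁ a₂ b₁ b₂ c₁ c₂ γ δ τ).comp_continuousOn h.contDiffOn.continuousOn

end IsSolution

/-- For large `d`, the energy identity, the one-sided Lipschitz bound and the Poincaré inequality
are compatible only if `w` equals its mean. -/
theorem IsSmoothBoundedDomain.exists_no_nonconstant (hΩ : IsSmoothBoundedDomain Ω)
    (ha₁ : 0 < a₁) (ha₂ : 0 < a₂) (hb₁ : 0 < b₁) (hc₂ : 0 < c₂) (hγ : 0 < γ) (hδ : 0 < δ) :
    ∃ dbar : ℝ, 0 < dbar ∧ ∀ d : ℝ, dbar < d → ∀ (w : EuclideanSpace ℝ (Fin N) → ℝ) (τ : ℝ),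
      IsSolution a₁ a₂ b₁ b₂ c₁ c₂ γ δ Ω d w τ → ∃ k : ℝ, ∀ x ∈ closure Ω, w x = k := by
  obtain ⟨C, hC0, hC⟩ := hΩ.exists_poincare
  have hV := hΩ.measureReal_pos
  set L := a₁ / δ + a₂ with hL
  have hL0 : 0 < L := by positivity
  refine ⟨L * C + 1, by positivity, fun d hd w τ h => ?_⟩
  have hc := h.contDiffOn.continuousOn
  set H := reactH a₁ a₂ b₁ b₂ c₁ c₂ γ δ τ with hH
  have hHc : ContinuousOn (fun y => H (w y)) (closure Ω) :=
    (continuous_reactH a₁ a₂ b₁ b₂ c₁ c₂ γ δ τ).comp_continuousOn hc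
  set m := (∫ y in Ω, w y) / volume.real Ω with hm
  have hm0 : ∫ y in Ω, (w y - m) = 0 := by
    rw [integral_sub (hΩ.integrableOn hc) (hΩ.integrableOn continuousOn_const), setIntegral_const,
      smul_eq_mul, hm, mul_div_cancel₀ _ hV.ne', sub_self]
  set I := ∫ y in Ω, ‖fderiv ℝ w y‖ ^ 2 with hI
  have hI0 : 0 ≤ I := integral_nonneg fun y => sq_nonneg _
  have hpoin : ∫ y in Ω, (w y - m) ^ 2 ≤ C * I := hC w m (h.contDiffOn.of_le one_le_two) hm0
  have hwm : ContinuousOn (fun y => w y - m) (closure Ω) := hc.sub continuousOn_const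
  have hsq : IntegrableOn (fun y => (w y - m) ^ 2) Ω := hΩ.integrableOn (hwm.pow 2)
  have hHw : IntegrableOn (fun y => H (w y) * (w y - m)) Ω := hΩ.integrableOn (hHc.mul hwm)
  have hHm : IntegrableOn (fun y => H m * (w y - m)) Ω :=
    hΩ.integrableOn (continuousOn_const.mul hwm)
  have henergy : d * I ≤ L * ∫ y in Ω, (w y - m) ^ 2 := by
    have e : d * I = ∫ y in Ω, (H (w y) - H m) * (w y - m) := by
      simp only [sub_mul]
      rw [h.energy_eq hΩ m, integral_sub hHw hHm, integral_const_mul, hm0, mul_zero, sub_zero]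
    rw [e, ← integral_const_mul]
    exact integral_mono (hΩ.integrableOn ((hHc.sub continuousOn_const).mul hwm)) (hsq.const_mul L)
      fun y => reactH_sub_mul_le ha₁ ha₂ hb₁ hc₂ hγ hδ h.tau_pos (w y) m
  have hIz : I = 0 := by
    have h1 := henergy.trans (mul_le_mul_of_nonneg_left hpoin hL0.le)
    nlinarith
  have hq : ∫ y in Ω, (w y - m) ^ 2 = 0 :=
    le_antisymm (by rwa [hIz, mul_zero] at hpoin) (integral_nonneg fun y => sq_nonneg _)
  rw [integral_eq_zero_iff_of_nonneg (fun y => sq_nonneg _) hsq] at hq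
  have hae : w =ᵐ[volume.restrict Ω] fun _ => m := by
    filter_upwards [hq] with y hy
    exact sub_eq_zero.1 (pow_eq_zero_iff two_ne_zero |>.1 hy)
  have heq : EqOn w (fun _ => m) Ω :=
    Measure.eqOn_open_of_ae_eq hae hΩ.isOpen (hc.mono subset_closure) continuousOn_const
  exact ⟨m, heq.of_subset_closure hc continuousOn_const subset_closure subset_rfl⟩

end Solutions

end FullCross

theorem theorem3p1 (a₁ a₂ b₁ b₂ c₁ c₂ γ δ : ℝ) (ha₁ : 0 < a₁) (ha₂ : 0 < a₂) (hb₁ : 0 < b₁)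
    (hb₂ : 0 < b₂) (hc₁ : 0 < c₁) (hc₂ : 0 < c₂) (hγ : 0 < γ) (hδ : 0 < δ) :
    (∃ Cstar : ℝ, 0 < Cstar ∧
      ∀ (N : ℕ), 1 ≤ N → ∀ Ω : Set (EuclideanSpace ℝ (Fin N)), FullCross.IsSmoothBoundedDomain Ω →
        ∀ (d : ℝ), 0 < d → ∀ (w : EuclideanSpace ℝ (Fin N) → ℝ) (τ : ℝ),
          FullCross.IsSolution a₁ a₂ b₁ b₂ c₁ c₂ γ δ Ω d w τ →
            eLpNorm w ∞ (volume.restrict (closure Ω)) ≤ ENNReal.ofReal Cstar ∧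
            τ ≤ min (a₁ ^ 2 / (4 * b₁ * c₁)) (a₂ ^ 2 / (4 * b₂ * c₂))) ∧
    (∀ (N : ℕ), 1 ≤ N → ∀ Ω : Set (EuclideanSpace ℝ (Fin N)), FullCross.IsSmoothBoundedDomain Ω →
      ∃ dbar : ℝ, 0 < dbar ∧ ∀ d : ℝ, dbar < d →
        ¬ ∃ (w : EuclideanSpace ℝ (Fin N) → ℝ) (τ : ℝ),
          FullCross.IsNonconstantSolution a₁ a₂ b₁ b₂ c₁ c₂ γ δ Ω d w τ) := by
  refine ⟨⟨max (δ * (a₁ / b₁ + (γ * b₂ * (a₁ ^ 2 / (4 * b₁ * c₁))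
      + c₂ * δ * (a₁ ^ 2 / (4 * b₁ * c₁))) / a₁))
      (γ * (a₂ / c₂ + (γ⁻¹ * c₁ * (a₁ ^ 2 / (4 * b₁ * c₁))
      + b₁ * δ⁻¹ * (a₁ ^ 2 / (4 * b₁ * c₁))) / a₂)), lt_max_of_lt_left (by positivity), ?_⟩, ?_⟩
  · intro N _ Ω hΩ d hd w τ h
    have hτ := h.tau_le hΩ hb₁ hb₂ hc₁ hc₂ hγ hδ
    refine ⟨?_, hτ⟩
    rw [eLpNorm_exponent_top]
    refine eLpNormEssSup_le_of_ae_bound ?_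
    refine (ae_restrict_iff' isClosed_closure.measurableSet).2 (Eventually.of_forall fun x hx => ?_)
    exact h.abs_le hΩ ha₁ ha₂ hb₁ hb₂ hc₁ hc₂ hγ hδ hd (hτ.trans (min_le_left _ _)) hx
  · intro N _ Ω hΩ
    obtain ⟨dbar, hpos, h⟩ := hΩ.exists_no_nonconstant (b₂ := b₂) (c₁ := c₁) ha₁ ha₂ hb₁ hc₂ hγ hδ
    exact ⟨dbar, hpos, fun d hd ⟨w, τ, hw, hne⟩ => hne (h d hd w τ hw)⟩
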